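/- Let $K$ be a field of characteristic $0$, let $S=K[x_1,\dots,x_n]$, and let $f\in S$ be a non-zero form. Let $I_f\subset S$ be the ideal of all $g\in S$ with $g(\partial/\partial x_1,\dots,\partial/\partial x_n)f=0$, and let $R_f=S/I_f$ with the standard grading induced by $S$. For $g\in S$ write $\partial f/\partial g = g(\partial/\partial x_1,\dots,\partial/\partial x_n)f$. For a standard graded $K$-algebra $R=\bigoplus_{i\ge 0}R_i$ with maximal homogeneous ideal $\mathfrak m=\bigoplus_{i>0}R_i$: - $R$ is *Koszul* if the matrices of the maps in the minimal free resolution of $K=R/\mathfrak m$ over $R$ have entries homogeneous of degree $1$. - $R$ is *G-quadratic* if for some system of coordinates (a basis of $R_1$) and some term order the ideal defining $R$ as a quotient of the polynomial ring in these coordinates has a Gröbner basis consisting of quadrics. - A *Koszul filtration* of $R$ is a family $F$ of ideals of $R$ such that every ideal in $F$ is generated by linear forms; $(0)$ and $\mathfrak m$ are in $F$; and for every non-zero $I\in F$ there is $J\in F$ with $J\subset I$, $I/J$ cyclic and $J:I\in F$. A form $f$ is *smooth* if the hypersurface $f=0$ in $\mathbf P^{n-1}$ has no singular point over the algebraic closure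 of $K$. The *rank* of a quadric is the rank of its matrix of second partial derivatives. A property holds for the *generic cubic* if it holds for all cubics in some non-empty Zariski open subset (defined over $K$) of the space of cubic forms in $n$ variables. **Theorem.** 1. Suppose $n\ge 3$ and let $f\in S$ be a non-zero cubic form. If there are linear forms $y,z\in S$ such that $\partial f/\partial(yz)=0$ and $\partial f/\partial y$, $\partial f/\partial z$ are quadrics of rank $n-1$, then $R_f$ has a Koszul filtration. 2. If $f\in S$ is a non-zero smooth cubic form, then $R_f$ is not G-quadratic. 3. If $n\ge 3$, then for the generic cubic $f\in S$ the algebra $R_f$ is Koszul and not G-quadratic. -/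

import Mathlib

open MvPolynomial

/-! ## Polynomials acting as differential operators, Macaulay inverse systems -/

section InverseSystem

variable {K : Type*} [Field K] {n : ℕ}

/-- Partial derivatives commute. -/
theorem pderiv_commute (i j : Fin n) :
    Commute ((pderiv i : Derivation K _ _).toLinearMap : Module.End K (MvPolynomial (Fin n) K))
      ((pderiv j : Derivation K _ _).toLinearMap) := by
  have h : ⁅(pderiv i : Derivation K (MvPolynomial (Fin n) K) (MvPolynomial (Fin n) K)),
      (pderiv j : Derivation K (MvPolynomial (Fin n) K) (MvPolynomial (Fin n) K))⁆ =
        (0 : Derivation K (MvPolynomial (Fin n) K) (MvPolynomial (Fin n) K)) := by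
    refine MvPolynomial.derivation_ext (fun k => ?_)
    rw [Derivation.commutator_apply]
    simp only [pderiv_X, Pi.single_apply]
    split_ifs <;> simp
  apply LinearMap.ext
  intro p
  have hp := congrArg (fun D : Derivation K (MvPolynomial (Fin n) K) (MvPolynomial (Fin n) K) => D p) h
  simp only [Derivation.commutator_apply, Derivation.zero_apply] at hp
  exact sub_eq_zero.mp hp

theorem pderiv_pow_commute (i j : Fin n) (a b : ℕ) :
    Commute (((pderiv i : Derivation K _ _).toLinearMap : Module.End K (MvPolynomial (Fin n) K)) ^ a)
      ((pderiv j : Derivation K _ _).toLinearMap ^ b) :=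
  (pderiv_commute i j).pow_pow a b

theorem pderiv_pow_pairwise (m : Fin n →₀ ℕ) :
    ((Finset.univ : Finset (Fin n)) : Set (Fin n)).Pairwise
      (Function.onFun Commute fun i => ((pderiv i : Derivation K _ _).toLinearMap :
        Module.End K (MvPolynomial (Fin n) K)) ^ m i) :=
  fun i _ j _ _ => pderiv_pow_commute i j (m i) (m j)

/-- The operator `∂^m = ∏ i, (∂/∂x_i)^(m i)`. -/
noncomputable def iterPDeriv (m : Fin n →₀ ℕ) : Module.End K (MvPolynomial (Fin n) K) :=
  Finset.univ.noncommProd (fun i => (pderiv i : Derivation K _ _).toLinearMap ^ m i)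
    (pderiv_pow_pairwise m)

theorem iterPDeriv_zero :
    iterPDeriv (0 : Fin n →₀ ℕ) = (1 : Module.End K (MvPolynomial (Fin n) K)) := by
  unfold iterPDeriv
  rw [Finset.noncommProd_eq_pow_card _ _ _ 1 (fun i _ => by simp)]
  simp

theorem iterPDeriv_add (m m' : Fin n →₀ ℕ) :
    (iterPDeriv (m + m') : Module.End K (MvPolynomial (Fin n) K)) =
      iterPDeriv m * iterPDeriv m' := by
  unfold iterPDeriv
  rw [← Finset.noncommProd_mul_distrib _ _ _ _
    (fun i _ j _ _ => pderiv_pow_commute i j (m' i) (m j))]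
  refine Finset.noncommProd_congr rfl (fun i _ => ?_) _
  simp [pow_add]

/-- The algebra homomorphism `g ↦ g(∂/∂x_1, …, ∂/∂x_n)` from `S = K[x_1, …, x_n]` to the
`K`-linear endomorphisms of `S`. -/
noncomputable def diffOp : MvPolynomial (Fin n) K →ₐ[K] Module.End K (MvPolynomial (Fin n) K) :=
  AddMonoidAlgebra.lift K (Module.End K (MvPolynomial (Fin n) K)) (Fin n →₀ ℕ)
    { toFun := fun m => iterPDeriv m.toAdd
      map_one' := iterPDeriv_zero
      map_mul' := fun m m' => iterPDeriv_add m.toAdd m'.toAdd }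

theorem diffOp_X (i : Fin n) (f : MvPolynomial (Fin n) K) : diffOp (X i) f = pderiv i f := by
  have h : (iterPDeriv (Finsupp.single i 1) : Module.End K (MvPolynomial (Fin n) K)) =
      (pderiv i : Derivation K _ _).toLinearMap := by
    unfold iterPDeriv
    rw [← Finset.mul_noncommProd_erase _ (Finset.mem_univ i)]
    refine (congrArg _ (Finset.noncommProd_eq_pow_card _ _ _ 1 fun j hj => ?_)).trans ?_
    · simp [(Finset.ne_of_mem_erase hj).symm]
    · simp
  have h2 : (diffOp (X i) : Module.End K (MvPolynomial (Fin n) K)) =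
      iterPDeriv (Finsupp.single i 1) :=
    (AddMonoidAlgebra.lift_single _ _ _).trans (one_smul _ _)
  rw [h2, h]
  rfl

/-- The ideal `I_f` of the polynomials `g` with `g(∂/∂x_1, …, ∂/∂x_n) f = 0`. -/
noncomputable def apolarIdeal (f : MvPolynomial (Fin n) K) : Ideal (MvPolynomial (Fin n) K) where
  carrier := {g | diffOp g f = 0}
  zero_mem' := by simp
  add_mem' := by
    intro a b ha hb
    simp only [Set.mem_ofPred_eq] at ha hb ⊢
    simp [ha, hb]
  smul_mem' := by
    intro c g hg
    simp only [Set.mem_ofPred_eq] at hg ⊢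
    simp [hg]

/-- The algebra `R_f = S / I_f`. -/
abbrev ApolarAlgebra (f : MvPolynomial (Fin n) K) : Type _ :=
  MvPolynomial (Fin n) K ⧸ apolarIdeal f

/-- The grading of `R_f` induced by the standard grading of `S`: the image of the forms of
degree `d` is the component of degree `d`. -/
noncomputable def apolarGrading (f : MvPolynomial (Fin n) K) (d : ℕ) :
    Submodule K (ApolarAlgebra f) :=
  (homogeneousSubmodule (Fin n) K d).map (Ideal.Quotient.mkₐ K (apolarIdeal f)).toLinearMap

end InverseSystem

/-! ## Forms: rank of a quadric, smoothness, generic forms -/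

section Forms

variable {K : Type*} [Field K] {n : ℕ}

/-- The rank of a quadratic form `q` (in characteristic `≠ 2`): the rank of its (constant)
Hessian matrix `(∂²q/∂x_i∂x_j)`. -/
noncomputable def quadricRank (q : MvPolynomial (Fin n) K) : ℕ :=
  (Matrix.of fun i j : Fin n => constantCoeff (pderiv i (pderiv j q))).rank

/-- The hypersurface `f = 0` in projective space is smooth: it has no singular point with
coordinates in the algebraic closure of `K`. -/
def IsSmoothForm (f : MvPolynomial (Fin n) K) : Prop :=
  ∀ p : Fin n → AlgebraicClosure K, p ≠ 0 → aeval p f = 0 → ∃ i, aeval p (pderiv i f) ≠ 0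

/-- A property `Q` holds for the generic form of degree `d` in `n` variables over an infinite
field `K`: it holds on a nonempty Zariski open subset of the space of forms of degree `d`, i.e.
there is a nonzero polynomial `P` in the coefficients such that `Q f` whenever `P` does not vanish
at the coefficients of `f`. -/
def HoldsForGenericForm (K : Type*) [Field K] (n d : ℕ)
    (Q : MvPolynomial (Fin n) K → Prop) : Prop :=
  ∃ P : MvPolynomial {m : Fin n →₀ ℕ // m.degree = d} K, P ≠ 0 ∧
    ∀ f : MvPolynomial (Fin n) K, f.IsHomogeneous d →
      eval (fun m => coeff m.1 f) P ≠ 0 → Q f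

end Forms

/-! ## Standard graded algebras: Koszul, Koszul filtrations, G-quadratic

In this section `R` is a standard graded `K`-algebra with components `𝒜 0, 𝒜 1, …`. -/

section Graded

variable {K R : Type*} [Field K] [CommRing R] [Algebra K R] (𝒜 : ℕ → Submodule K R)

/-- The maximal homogeneous ideal `⊕_{i > 0} R_i`. -/
def maxHomogeneousIdeal : Ideal R :=
  Ideal.span {a | ∃ i > 0, a ∈ 𝒜 i}

/-- `R` is Koszul: the residue field `K = R/m` has a minimal free resolution
`⋯ → R^{b 2} → R^{b 1} → R^{b 0} = R → K → 0` whose maps are given by matrices with entries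
homogeneous of degree `1`. (Such a resolution is automatically minimal.) -/
def IsKoszulAlgebra : Prop :=
  ∃ (b : ℕ → ℕ) (M : ∀ i, Matrix (Fin (b i)) (Fin (b (i + 1))) R),
    b 0 = 1 ∧
    (∀ i j k, M i j k ∈ 𝒜 1) ∧
    (∀ v, v ∈ LinearMap.range (M 0).mulVecLin ↔ ∀ j, v j ∈ maxHomogeneousIdeal 𝒜) ∧
    (∀ i, LinearMap.range (M (i + 1)).mulVecLin = LinearMap.ker (M i).mulVecLin)

/-- `F` is a Koszul filtration of `R`: every ideal of `F` is generated by linear forms, the zero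
ideal and the maximal homogeneous ideal are in `F`, and for every nonzero `I ∈ F` there is
`J ∈ F` with `J ⊂ I`, `I/J` cyclic and `J : I ∈ F`. -/
structure IsKoszulFiltration (F : Set (Ideal R)) : Prop where
  generated_by_linear : ∀ I ∈ F, ∃ s : Set R, s ⊆ (𝒜 1 : Set R) ∧ I = Ideal.span s
  bot_mem : ⊥ ∈ F
  max_mem : maxHomogeneousIdeal 𝒜 ∈ F
  exists_colon : ∀ I ∈ F, I ≠ ⊥ → ∃ J ∈ F, J < I ∧
    (∃ a, I = J ⊔ Ideal.span {a}) ∧ Submodule.colon J (I : Set R) ∈ F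

/-- `G` is a Gröbner basis of the ideal `I` for the term order `ord`: `G ⊆ I` and the leading
terms of the elements of `G` generate the ideal generated by the leading terms of the elements
of `I`. -/
def IsGroebnerBasisOf {m : ℕ} (ord : MonomialOrder.{0, 0} (Fin m))
    (G : Set (MvPolynomial (Fin m) K)) (I : Ideal (MvPolynomial (Fin m) K)) : Prop :=
  G ⊆ (I : Set (MvPolynomial (Fin m) K)) ∧
    Ideal.span (ord.leadingTerm '' G) =
      Ideal.span (ord.leadingTerm '' (I : Set (MvPolynomial (Fin m) K)))

/-- `R` is G-quadratic: for some system of coordinates (a basis `c` of `R_1`) and some term order,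
the defining ideal of `R` with respect to these coordinates (the kernel of
`K[x_1, …, x_m] → R`, `x_i ↦ c i`) has a Gröbner basis of quadrics. -/
def IsGQuadratic : Prop :=
  ∃ (m : ℕ) (c : Module.Basis (Fin m) K (𝒜 1)) (ord : MonomialOrder.{0, 0} (Fin m))
    (G : Set (MvPolynomial (Fin m) K)),
    (∀ g ∈ G, g.IsHomogeneous 2) ∧
    IsGroebnerBasisOf ord G
      (RingHom.ker (aeval (fun i => (c i : R)) : MvPolynomial (Fin m) K →ₐ[K] R))

end Graded

/-! ### Apolar duality on `R_f` -/

section ApolarPairing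

variable {K : Type*} [Field K] {n : ℕ}

/-! Write λ for the functional g ↦ (g(∂)f)(0) on R = R_f. In characteristic 0 the form (a, b) ↦
λ(ab) is nondegenerate, and for a cubic it pairs R_d perfectly with R_{3-d}; in particular R_d = 0
for d > 3. A linear form y acts from R_1 to R_2 ≅ R_1^* through the Hessian matrix of ∂f/∂y.

Koszul filtration. If yz = 0 and both Hessians have corank one, then ann(y) = (z) and ann(z) = (y),
and yR_1 is the hyperplane {q : λ(zq) = 0} of R_2. Hence y together with any independent linear form
generates all of R_2 and R_3. This makes 0, (z) and all ideals generated by subspaces of R_1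
containing y a Koszul filtration (`IsCorankOnePair.isKoszulFiltration`): when y ∈ U and a ∉ U, the
colon (U) : a contains y and, by a dimension count using n ≥ 3, a second independent linear form, so
it is generated by linear forms.

Smooth cubics. Given a Gröbner basis of quadrics, let x be the smallest variable. As R_4 = 0, x^4 is
a leading monomial of the defining ideal, so some basis element has leading monomial x^2. This is
the smallest monomial of degree 2, so that element is a multiple of x^2. Thus R has a nonzero linear
form of square zero, and its coefficient vector is a singular point of f by Euler's identity.

Generic cubics. Smoothness follows from the nonvanishing of a Macaulay determinant of the partial
derivatives, a polynomial in the coefficients of f that is nonzero at the Fermat cubic. A corank-one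
pair is sought with y in a fixed pencil, at a parameter where the contraction of f by y is singular,
and with z a column of the adjugate. That z works at some such parameter is ensured by a nonzero
remainder of one explicit polynomial modulo a characteristic polynomial, again a polynomial
condition on f. The parameter is an eigenvalue, so the pair lives over the algebraic closure L only.
Koszulness nevertheless descends: B = R_{f_L} is a free R-algebra, the filtration of B gives B/mB a
linear resolution over R (`hasLinearResolution_of_filtration`), and R/m is a direct summand of B/mB
(`hasLinearResolution_residue_of_free`). -/

theorem diffOp_mul_apply (g h f : MvPolynomial (Fin n) K) :
    diffOp (g * h) f = diffOp g (diffOp h f) := by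
  rw [map_mul]; rfl

/-- The constant is the product of the factorial quotients (k_i + m_i)!/k_i!, nonzero in
characteristic 0. It is the source of the duality on `R_f`. -/
theorem exists_coeff_diffOp_monomial [CharZero K] (m : Fin n →₀ ℕ) : ∀ k : Fin n →₀ ℕ,
    ∃ c : K, c ≠ 0 ∧ ∀ h : MvPolynomial (Fin n) K,
      coeff k (diffOp (monomial m 1) h) = c * coeff (k + m) h := by
  induction m using Finsupp.induction_linear with
  | zero => intro k; exact ⟨1, one_ne_zero, fun h => by
      have : (monomial (0 : Fin n →₀ ℕ) (1 : K)) = 1 := rfl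
      rw [this]; simp⟩
  | add a b ha hb =>
    intro k
    obtain ⟨c, hc, h1⟩ := ha k
    obtain ⟨d, hd, h2⟩ := hb (k + a)
    refine ⟨c * d, mul_ne_zero hc hd, fun h => ?_⟩
    have : (monomial (a + b) (1 : K)) = monomial a 1 * monomial b 1 := by
      rw [monomial_mul, one_mul]
    rw [this, diffOp_mul_apply, h1, h2, mul_assoc, add_assoc]
  | single i b =>
    induction b with
    | zero => intro k; exact ⟨1, one_ne_zero, fun h => by
        have : (monomial (Finsupp.single i 0 : Fin n →₀ ℕ) (1 : K)) = 1 := by simp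
        rw [this]; simp⟩
    | succ b ih =>
      intro k
      obtain ⟨c, hc, h1⟩ := ih k
      refine ⟨c * ((k + Finsupp.single i b) i + 1), mul_ne_zero hc (Nat.cast_add_one_ne_zero _),
        fun h => ?_⟩
      have : (monomial (Finsupp.single i (b + 1)) (1 : K)) = monomial (Finsupp.single i b) 1 * X i := by
        rw [X, monomial_mul, one_mul, Finsupp.single_add]
      rw [this, diffOp_mul_apply, diffOp_X, h1, coeff_pderiv, Finsupp.single_add, add_assoc]
      ring

/-- The linear form `g ↦ g(∂)f (0)` on `R_f`. -/
noncomputable def apolarForm (f : MvPolynomial (Fin n) K) : ApolarAlgebra f →ₗ[K] K :=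
  ((apolarIdeal f).restrictScalars K).liftQ
    ((lcoeff K 0) ∘ₗ ((LinearMap.applyₗ f) ∘ₗ (diffOp (K := K) (n := n)).toLinearMap))
    (fun g hg => by
      have : diffOp g f = 0 := hg
      simp [this])

theorem apolarForm_mk (f g : MvPolynomial (Fin n) K) :
    apolarForm f (Ideal.Quotient.mk _ g) = coeff 0 (diffOp g f) := rfl

theorem apolar_mk_eq_zero_iff {f g : MvPolynomial (Fin n) K} :
    Ideal.Quotient.mk (apolarIdeal f) g = 0 ↔ diffOp g f = 0 :=
  Ideal.Quotient.eq_zero_iff_mem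

/-- Up to a nonzero scalar, the coefficient of x^m in g(∂)f is the constant term of ∂^m g(∂)f, so
pairing g with all monomials recovers g(∂)f. -/
theorem apolarForm_nondegenerate [CharZero K] {f : MvPolynomial (Fin n) K} {a : ApolarAlgebra f}
    (h : ∀ b, apolarForm f (a * b) = 0) : a = 0 := by
  obtain ⟨g, rfl⟩ := Ideal.Quotient.mk_surjective a
  rw [apolar_mk_eq_zero_iff]
  ext m
  obtain ⟨c, hc, h1⟩ := exists_coeff_diffOp_monomial (K := K) m 0
  have h2 := h (Ideal.Quotient.mk _ (monomial m 1))
  rw [← map_mul, apolarForm_mk, mul_comm, diffOp_mul_apply, h1, zero_add] at h2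
  simpa [hc] using h2

theorem mem_apolarGrading {f : MvPolynomial (Fin n) K} {d : ℕ} {a : ApolarAlgebra f} :
    a ∈ apolarGrading f d ↔
      ∃ g : MvPolynomial (Fin n) K, g.IsHomogeneous d ∧ Ideal.Quotient.mk _ g = a := by
  simp only [apolarGrading, Submodule.mem_map, mem_homogeneousSubmodule]
  rfl

theorem mk_mem_apolarGrading {f g : MvPolynomial (Fin n) K} {d : ℕ} (h : g.IsHomogeneous d) :
    Ideal.Quotient.mk (apolarIdeal f) g ∈ apolarGrading f d :=
  mem_apolarGrading.2 ⟨g, h, rfl⟩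

theorem mul_mem_apolarGrading {f : MvPolynomial (Fin n) K} {d e : ℕ} {a b : ApolarAlgebra f}
    (ha : a ∈ apolarGrading f d) (hb : b ∈ apolarGrading f e) : a * b ∈ apolarGrading f (d + e) := by
  obtain ⟨g, hg, rfl⟩ := mem_apolarGrading.1 ha
  obtain ⟨h, hh, rfl⟩ := mem_apolarGrading.1 hb
  rw [← map_mul]
  exact mk_mem_apolarGrading (hg.mul hh)

theorem apolarForm_eq_zero [CharZero K] {f : MvPolynomial (Fin n) K} {e d : ℕ}
    (hf : f.IsHomogeneous e) (hd : d ≠ e) {a : ApolarAlgebra f} (ha : a ∈ apolarGrading f d) :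
    apolarForm f a = 0 := by
  obtain ⟨g, hg, rfl⟩ := mem_apolarGrading.1 ha
  rw [apolarForm_mk, g.as_sum, map_sum, LinearMap.sum_apply, coeff_sum]
  refine Finset.sum_eq_zero fun m hm => ?_
  obtain ⟨c, -, h1⟩ := exists_coeff_diffOp_monomial (K := K) m 0
  have hm' : m.degree = d := by
    by_contra hne
    exact (mem_support_iff.1 hm) (hg.coeff_eq_zero hne)
  have : monomial m (coeff m g) = (coeff m g) • monomial m (1 : K) := by simp [smul_monomial]
  rw [this, map_smul, LinearMap.smul_apply, coeff_smul, h1, zero_add,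
    hf.coeff_eq_zero (by omega), mul_zero, smul_zero]

theorem exists_sum_apolarGrading {f : MvPolynomial (Fin n) K} (a : ApolarAlgebra f) :
    ∃ (N : ℕ) (c : ℕ → ApolarAlgebra f), (∀ d, c d ∈ apolarGrading f d) ∧
      a = ∑ d ∈ Finset.range N, c d := by
  obtain ⟨g, rfl⟩ := Ideal.Quotient.mk_surjective a
  refine ⟨g.totalDegree + 1, fun d => Ideal.Quotient.mk _ (homogeneousComponent d g), fun d =>
    mk_mem_apolarGrading (homogeneousComponent_isHomogeneous d g), ?_⟩
  rw [← map_sum, sum_homogeneousComponent]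

/-- Elements of degree larger than the degree of `f` vanish. -/
theorem apolarGrading_eq_zero [CharZero K] {f : MvPolynomial (Fin n) K} {e d : ℕ}
    (hf : f.IsHomogeneous e) (hd : e < d) {a : ApolarAlgebra f} (ha : a ∈ apolarGrading f d) :
    a = 0 := by
  refine apolarForm_nondegenerate fun b => ?_
  obtain ⟨N, c, hc, rfl⟩ := exists_sum_apolarGrading b
  rw [Finset.mul_sum, map_sum]
  exact Finset.sum_eq_zero fun i _ =>
    apolarForm_eq_zero hf (by omega) (mul_mem_apolarGrading ha (hc i))

theorem exists_cubic_decomposition [CharZero K] {f : MvPolynomial (Fin n) K}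
    (hf : f.IsHomogeneous 3) (a : ApolarAlgebra f) :
    ∃ (c : K), ∃ a₁ ∈ apolarGrading f 1, ∃ a₂ ∈ apolarGrading f 2, ∃ a₃ ∈ apolarGrading f 3,
      a = algebraMap K _ c + a₁ + a₂ + a₃ := by
  obtain ⟨g, rfl⟩ := Ideal.Quotient.mk_surjective a
  refine ⟨coeff 0 g, _, mk_mem_apolarGrading (homogeneousComponent_isHomogeneous 1 g),
    _, mk_mem_apolarGrading (homogeneousComponent_isHomogeneous 2 g),
    _, mk_mem_apolarGrading (homogeneousComponent_isHomogeneous 3 g), ?_⟩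
  have h0 : algebraMap K (ApolarAlgebra f) (coeff 0 g) =
    Ideal.Quotient.mk _ (homogeneousComponent 0 g) := by
    rw [homogeneousComponent_zero]; rfl
  rw [h0, ← map_add, ← map_add, ← map_add]
  conv_lhs => rw [← sum_homogeneousComponent g]
  rw [show homogeneousComponent 0 g + homogeneousComponent 1 g + homogeneousComponent 2 g +
    homogeneousComponent 3 g = ∑ i ∈ Finset.range 4, homogeneousComponent i g by
      simp [Finset.sum_range_succ]]
  have key : ∀ N, Ideal.Quotient.mk (apolarIdeal f)
      (∑ i ∈ Finset.range (N + 4), homogeneousComponent i g) =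
      Ideal.Quotient.mk (apolarIdeal f) (∑ i ∈ Finset.range 4, homogeneousComponent i g) := by
    intro N
    induction N with
    | zero => rfl
    | succ N ih =>
      rw [show N + 1 + 4 = (N + 4) + 1 by ring, Finset.sum_range_succ, map_add, ih,
        apolarGrading_eq_zero hf (d := N + 4) (by omega)
          (mk_mem_apolarGrading (homogeneousComponent_isHomogeneous _ g)), add_zero]
  rw [← key g.totalDegree]
  congr 1
  refine Finset.sum_subset (Finset.range_mono (by omega)) fun i _ hi => ?_
  exact homogeneousComponent_eq_zero _ _ (by simpa using hi)

end ApolarPairing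

/-! ### Graded pieces and Hessians for a cubic -/

section CubicGrading

variable {K : Type*} [Field K] {n : ℕ} {f : MvPolynomial (Fin n) K}

theorem apolarGrading_pow (f : MvPolynomial (Fin n) K) (d : ℕ) :
    apolarGrading f 1 ^ d = apolarGrading f d := by
  unfold apolarGrading
  rw [← homogeneousSubmodule_one_pow (σ := Fin n) (R := K) d]
  exact (Submodule.map_pow _ (Ideal.Quotient.mkₐ K (apolarIdeal f)) d).symm

theorem eq_zero_of_apolarForm_mul [CharZero K] {d e : ℕ} (hf : f.IsHomogeneous (d + e)) {a : ApolarAlgebra f}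
    (ha : a ∈ apolarGrading f d) (h : ∀ b ∈ apolarGrading f e, apolarForm f (a * b) = 0) :
    a = 0 := by
  refine apolarForm_nondegenerate fun b => ?_
  obtain ⟨N, c, hc, rfl⟩ := exists_sum_apolarGrading b
  rw [Finset.mul_sum, map_sum]
  refine Finset.sum_eq_zero fun i _ => ?_
  by_cases hi : i = e
  · subst hi; exact h _ (hc i)
  · exact apolarForm_eq_zero hf (by omega) (mul_mem_apolarGrading ha (hc i))

/-- Pairing with R_{3-d} kills every component except the one of degree d, which duality then
detects. This gives directness of the grading without constructing a graded ring structure. -/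
theorem cubic_decomposition_unique [CharZero K] (hf : f.IsHomogeneous 3) {a₀ a₁ a₂ a₃ : ApolarAlgebra f}
    (h0 : a₀ ∈ apolarGrading f 0) (h1 : a₁ ∈ apolarGrading f 1) (h2 : a₂ ∈ apolarGrading f 2)
    (h3 : a₃ ∈ apolarGrading f 3) (h : a₀ + a₁ + a₂ + a₃ = 0) :
    a₀ = 0 ∧ a₁ = 0 ∧ a₂ = 0 ∧ a₃ = 0 := by
  have key : ∀ b, apolarForm f (a₀ * b) + apolarForm f (a₁ * b) + apolarForm f (a₂ * b) +
      apolarForm f (a₃ * b) = 0 := fun b => by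
    rw [← map_add, ← map_add, ← map_add, ← add_mul, ← add_mul, ← add_mul, h, zero_mul, map_zero]
  have z : ∀ {d e : ℕ} {a b : ApolarAlgebra f}, d + e ≠ 3 → a ∈ apolarGrading f d →
      b ∈ apolarGrading f e → apolarForm f (a * b) = 0 := fun hde ha hb =>
    apolarForm_eq_zero hf hde (mul_mem_apolarGrading ha hb)
  refine ⟨eq_zero_of_apolarForm_mul (d := 0) (e := 3) hf h0 fun b hb => ?_,
    eq_zero_of_apolarForm_mul (d := 1) (e := 2) hf h1 fun b hb => ?_,
    eq_zero_of_apolarForm_mul (d := 2) (e := 1) hf h2 fun b hb => ?_,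
    eq_zero_of_apolarForm_mul (d := 3) (e := 0) hf h3 fun b hb => ?_⟩
  · simpa [z (by norm_num) h1 hb, z (by norm_num) h2 hb, z (by norm_num) h3 hb] using key b
  · simpa [z (by norm_num) h0 hb, z (by norm_num) h2 hb, z (by norm_num) h3 hb] using key b
  · simpa [z (by norm_num) h0 hb, z (by norm_num) h1 hb, z (by norm_num) h3 hb] using key b
  · simpa [z (by norm_num) h0 hb, z (by norm_num) h1 hb, z (by norm_num) h2 hb] using key b

theorem algebraMap_mem_apolarGrading (f : MvPolynomial (Fin n) K) (c : K) :
    algebraMap K (ApolarAlgebra f) c ∈ apolarGrading f 0 :=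
  mk_mem_apolarGrading (g := C c) (isHomogeneous_C _ c)

theorem apolarAlgebra_nontrivial (hf0 : f ≠ 0) : Nontrivial (ApolarAlgebra f) := by
  refine Ideal.Quotient.nontrivial_iff.2 fun h => hf0 ?_
  have : (1 : MvPolynomial (Fin n) K) ∈ apolarIdeal f := h ▸ Submodule.mem_top
  have h1 : diffOp 1 f = 0 := this
  simpa using h1

theorem maxHomogeneousIdeal_eq_span (f : MvPolynomial (Fin n) K) :
    maxHomogeneousIdeal (apolarGrading f) = Ideal.span (apolarGrading f 1 : Set (ApolarAlgebra f)) := by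
  refine le_antisymm (Ideal.span_le.2 ?_) (Ideal.span_mono fun a ha => ⟨1, one_pos, ha⟩)
  rintro a ⟨i, hi, ha⟩
  obtain ⟨j, rfl⟩ : ∃ j, i = j + 1 := ⟨i - 1, by omega⟩
  have hp : apolarGrading f 1 ^ (j + 1) = apolarGrading f 1 ^ j * apolarGrading f 1 := rfl
  rw [← apolarGrading_pow, hp] at ha
  refine Submodule.mul_induction_on ha (fun b _ c hc => ?_) (fun b c hb hc => add_mem hb hc)
  exact Ideal.mul_mem_left _ _ (Ideal.subset_span hc)

theorem mem_maxHomogeneousIdeal {d : ℕ} (hd : 0 < d) {a : ApolarAlgebra f}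
    (ha : a ∈ apolarGrading f d) : a ∈ maxHomogeneousIdeal (apolarGrading f) :=
  Ideal.subset_span ⟨d, hd, ha⟩

/-- The linear form with coefficients `v` in `R_f`. -/
noncomputable def apolarLinear (f : MvPolynomial (Fin n) K) : (Fin n → K) →ₗ[K] ApolarAlgebra f :=
  Fintype.linearCombination K fun i => Ideal.Quotient.mk (apolarIdeal f) (X i)

theorem apolarLinear_mem (v : Fin n → K) : apolarLinear f v ∈ apolarGrading f 1 := by
  rw [apolarLinear, Fintype.linearCombination_apply]
  exact Submodule.sum_mem _ fun i _ => Submodule.smul_mem _ _ (mk_mem_apolarGrading (isHomogeneous_X _ i))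

theorem apolarGrading_one_eq_range (f : MvPolynomial (Fin n) K) :
    apolarGrading f 1 = LinearMap.range (apolarLinear f) := by
  rw [apolarLinear, Fintype.range_linearCombination, apolarGrading,
    homogeneousSubmodule_one_eq_span_X, Submodule.map_span, ← Set.range_comp]
  rfl

theorem exists_apolarLinear_eq {a : ApolarAlgebra f} (ha : a ∈ apolarGrading f 1) :
    ∃ v, apolarLinear f v = a := by
  rwa [apolarGrading_one_eq_range] at ha

/-- The matrix of the bilinear form `(v, w) ↦ apolarForm f (a * v * w)` on linear forms. -/
noncomputable def apolarHessian (f : MvPolynomial (Fin n) K) (a : ApolarAlgebra f) :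
    Matrix (Fin n) (Fin n) K :=
  Matrix.of fun i j => apolarForm f (a * Ideal.Quotient.mk _ (X i) * Ideal.Quotient.mk _ (X j))

theorem apolarHessian_isSymm (a : ApolarAlgebra f) : (apolarHessian f a).IsSymm := by
  ext i j
  simp only [apolarHessian, Matrix.transpose_apply, Matrix.of_apply]
  congr 1; ring

theorem apolarHessian_mulVec (a : ApolarAlgebra f) (v : Fin n → K) (i : Fin n) :
    (apolarHessian f a).mulVec v i =
      apolarForm f (a * apolarLinear f v * Ideal.Quotient.mk _ (X i)) := by
  simp only [apolarHessian, Matrix.mulVec, dotProduct, Matrix.of_apply, apolarLinear,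
    Fintype.linearCombination_apply, Finset.mul_sum, Finset.sum_mul, map_sum]
  refine Finset.sum_congr rfl fun j _ => ?_
  rw [mul_smul_comm, smul_mul_assoc, map_smul, smul_eq_mul, mul_comm (v j)]
  congr 2; ring

theorem eq_zero_of_apolarForm_mul_X [CharZero K] (hf : f.IsHomogeneous 3) {q : ApolarAlgebra f}
    (hq : q ∈ apolarGrading f 2)
    (h : ∀ i, apolarForm f (q * Ideal.Quotient.mk _ (X i)) = 0) : q = 0 := by
  refine eq_zero_of_apolarForm_mul (d := 2) (e := 1) hf hq fun b hb => ?_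
  obtain ⟨v, rfl⟩ := exists_apolarLinear_eq hb
  rw [apolarLinear, Fintype.linearCombination_apply, Finset.mul_sum, map_sum]
  exact Finset.sum_eq_zero fun i _ => by rw [mul_smul_comm, map_smul, h, smul_zero]

/-- Turns the rank hypothesis into a statement about multiplication by y from R_1 to R_2. -/
theorem quadricRank_diffOp (f y : MvPolynomial (Fin n) K) :
    quadricRank (diffOp y f) = (apolarHessian f (Ideal.Quotient.mk _ y)).rank := by
  unfold quadricRank apolarHessian
  congr 1
  ext i j
  rw [Matrix.of_apply, Matrix.of_apply, ← map_mul, ← map_mul, apolarForm_mk, constantCoeff_eq,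
    ← diffOp_X, ← diffOp_X, ← diffOp_mul_apply, ← diffOp_mul_apply]
  congr 3; ring

end CubicGrading

/-! ### Symmetric matrices of corank one -/

section CorankOne

variable {K : Type*} [Field K] {n : ℕ}

theorem Matrix.exists_smul_eq_of_corank_one {H : Matrix (Fin n) (Fin n) K} (hr : H.rank + 1 = n)
    {z w : Fin n → K} (hz0 : z ≠ 0) (hz : H.mulVec z = 0) (hw : H.mulVec w = 0) :
    ∃ c : K, w = c • z := by
  have h1 : Module.finrank K (LinearMap.ker H.mulVecLin) = 1 := by
    have := LinearMap.finrank_range_add_finrank_ker H.mulVecLin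
    rw [Module.finrank_fin_fun] at this
    change H.rank + _ = n at this
    omega
  obtain ⟨c, hc⟩ := (finrank_eq_one_iff_of_nonzero' (⟨z, hz⟩ : LinearMap.ker H.mulVecLin)
    (fun h => hz0 (congrArg Subtype.val h))).1 h1 ⟨w, hw⟩
  exact ⟨c, (congrArg Subtype.val hc).symm⟩

/-- By symmetry the image lies in the hyperplane orthogonal to the kernel vector z, and both have
dimension n - 1. -/
theorem Matrix.exists_mulVec_eq_of_corank_one {H : Matrix (Fin n) (Fin n) K} (hs : H.IsSymm)
    (hr : H.rank + 1 = n) {z u : Fin n → K} (hz0 : z ≠ 0) (hz : H.mulVec z = 0)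
    (hu : z ⬝ᵥ u = 0) : ∃ v, H.mulVec v = u := by
  let φ : (Fin n → K) →ₗ[K] K := dotProductBilin K K z
  have hle : LinearMap.range H.mulVecLin ≤ LinearMap.ker φ := by
    rintro _ ⟨v, rfl⟩
    change z ⬝ᵥ H.mulVec v = 0
    rw [Matrix.dotProduct_mulVec, ← Matrix.mulVec_transpose, hs.eq, hz, zero_dotProduct]
  have hφ : φ ≠ 0 := by
    intro h
    apply hz0
    ext i
    have := LinearMap.congr_fun h (Pi.single i 1)
    simpa [φ] using this
  have hk : Module.finrank K (LinearMap.ker φ) + 1 = n := by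
    have := Module.Dual.finrank_ker_add_one_of_ne_zero hφ
    rwa [Module.finrank_fin_fun] at this
  have heq := Submodule.eq_of_le_of_finrank_eq hle (by
    change H.rank = _
    omega)
  have : u ∈ LinearMap.range H.mulVecLin := by rw [heq]; exact hu
  exact this

end CorankOne

/-! ### Exact pairs of linear forms -/

section ExactPair

theorem apolarAlgebra_smul_def {K : Type*} [Field K] {n : ℕ} {f : MvPolynomial (Fin n) K} (c : K)
    (a : ApolarAlgebra f) : c • a = algebraMap K (ApolarAlgebra f) c * a :=
  Algebra.smul_def c a

variable {K : Type*} [Field K] {n : ℕ} {f : MvPolynomial (Fin n) K}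

theorem exists_apolarForm_mul_ne_zero [CharZero K] {d e : ℕ} (hf : f.IsHomogeneous (d + e))
    {a : ApolarAlgebra f} (ha : a ∈ apolarGrading f d) (ha0 : a ≠ 0) :
    ∃ b ∈ apolarGrading f e, apolarForm f (a * b) ≠ 0 := by
  by_contra! h
  exact ha0 (eq_zero_of_apolarForm_mul hf ha h)

/-- The socle lies in every non-zero ideal generated by a form of degree `1`. -/
theorem apolarGrading_three_le [CharZero K] (hf : f.IsHomogeneous 3) {a : ApolarAlgebra f}
    (ha : a ∈ apolarGrading f 1) (ha0 : a ≠ 0) {s : ApolarAlgebra f} (hs : s ∈ apolarGrading f 3) :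
    ∃ q ∈ apolarGrading f 2, s = a * q := by
  obtain ⟨q, hq, h⟩ := exists_apolarForm_mul_ne_zero (d := 1) (e := 2) hf ha ha0
  have haq := mul_mem_apolarGrading ha hq
  -- R_3 is at most one-dimensional and detected by `apolarForm`; the scalar makes the values of s
  -- and a * q agree.
  refine ⟨(apolarForm f s / apolarForm f (a * q)) • q, Submodule.smul_mem _ _ hq, ?_⟩
  rw [← sub_eq_zero, mul_smul_comm]
  refine eq_zero_of_apolarForm_mul (d := 3) (e := 0) hf
    (sub_mem hs (Submodule.smul_mem _ _ haq)) fun b hb => ?_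
  obtain ⟨g, hg, rfl⟩ := mem_apolarGrading.1 hb
  obtain ⟨c, rfl⟩ : ∃ c, g = C c := by
    rw [← mem_homogeneousSubmodule, homogeneousSubmodule_zero] at hg
    obtain ⟨c, hc⟩ := Submodule.mem_one.1 hg
    exact ⟨c, hc.symm⟩
  have : Ideal.Quotient.mk (apolarIdeal f) (C c) = algebraMap K (ApolarAlgebra f) c := rfl
  rw [this, mul_comm, ← Algebra.smul_def, map_smul, map_sub, map_smul, smul_eq_mul, smul_eq_mul,
    div_mul_cancel₀ _ h, sub_self, mul_zero]

/-- If `yz = 0` and multiplication by `z` on linear forms has a one-dimensional kernel,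
then it is spanned by `y`. -/
theorem exists_smul_eq_of_mul_eq_zero {y z : ApolarAlgebra f}
    (hy0 : y ≠ 0) (hyz : y * z = 0)
    (hz : (apolarHessian f z).rank + 1 = n)
    {v : Fin n → K} (h : z * apolarLinear f v = 0) {v₀ : Fin n → K} (hv₀ : apolarLinear f v₀ = y) :
    ∃ c : K, v = c • v₀ := by
  refine Matrix.exists_smul_eq_of_corank_one hz (z := v₀) ?_ ?_ ?_
  · rintro rfl; exact hy0 (by rw [← hv₀, map_zero])
  · ext i; rw [apolarHessian_mulVec, hv₀, mul_comm z, hyz, zero_mul, map_zero]; rfl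
  · ext i; rw [apolarHessian_mulVec, h, zero_mul, map_zero]; rfl

/-- By duality q is a functional on R_1. It lies in the image of the Hessian of y exactly when it
vanishes on the kernel, which is spanned by z; so yR_1 is a hyperplane of R_2 with equation λ(zq) =
0. -/
theorem exists_mul_eq_of_apolarForm_mul_eq_zero [CharZero K] (hf : f.IsHomogeneous 3) {y z : ApolarAlgebra f}
    (hy : y ∈ apolarGrading f 1) (hz : z ∈ apolarGrading f 1) (hz0 : z ≠ 0) (hyz : y * z = 0)
    (hyr : (apolarHessian f y).rank + 1 = n)
    {q : ApolarAlgebra f} (hq : q ∈ apolarGrading f 2) (h : apolarForm f (z * q) = 0) :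
    ∃ w ∈ apolarGrading f 1, q = y * w := by
  obtain ⟨z₀, rfl⟩ := exists_apolarLinear_eq hz
  have hz' : (apolarHessian f y).mulVec z₀ = 0 := by
    ext i; rw [apolarHessian_mulVec, hyz, zero_mul, map_zero]; rfl
  obtain ⟨v, hv⟩ := Matrix.exists_mulVec_eq_of_corank_one (apolarHessian_isSymm y) hyr (z := z₀)
    (u := fun i => apolarForm f (q * Ideal.Quotient.mk _ (X i)))
    (by rintro rfl; exact hz0 (map_zero _)) hz' (by
      rw [← h]
      simp only [apolarLinear, Fintype.linearCombination_apply, Finset.sum_mul, map_sum,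
        dotProduct, smul_mul_assoc, map_smul, smul_eq_mul]
      exact Finset.sum_congr rfl fun i _ => by rw [mul_comm q])
  refine ⟨apolarLinear f v, apolarLinear_mem v, ?_⟩
  rw [← sub_eq_zero]
  refine eq_zero_of_apolarForm_mul_X hf
    (sub_mem hq (mul_mem_apolarGrading hy (apolarLinear_mem v))) fun i => ?_
  rw [sub_mul, map_sub, ← apolarHessian_mulVec, hv, sub_self]

theorem ne_zero_of_apolarHessian_rank {y : ApolarAlgebra f} (h : (apolarHessian f y).rank ≠ 0) :
    y ≠ 0 := by
  rintro rfl
  apply h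
  have : apolarHessian f 0 = 0 := by ext; simp [apolarHessian]
  rw [this, Matrix.rank_zero]

/-- A pair of linear forms with `yz = 0` whose multiplication maps have corank one. -/
structure IsCorankOnePair (f : MvPolynomial (Fin n) K) (y z : ApolarAlgebra f) : Prop where
  left_mem : y ∈ apolarGrading f 1
  right_mem : z ∈ apolarGrading f 1
  mul_eq_zero : y * z = 0
  left_rank : (apolarHessian f y).rank + 1 = n
  right_rank : (apolarHessian f z).rank + 1 = n

variable {y z : ApolarAlgebra f}

theorem IsCorankOnePair.symm (h : IsCorankOnePair f y z) : IsCorankOnePair f z y :=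
  ⟨h.2, h.1, by rw [mul_comm, h.3], h.5, h.4⟩

theorem IsCorankOnePair.left_ne_zero (h : IsCorankOnePair f y z) (hn : 3 ≤ n) : y ≠ 0 :=
  ne_zero_of_apolarHessian_rank (by have := h.left_rank; omega)

/-- The annihilator of y is computed degree by degree: nothing in degree 0, the kernel line spanned
by z in degree 1, the hyperplane zR_1 in degree 2, and in degree 3 the socle, which lies in every
nonzero principal ideal generated by a linear form. -/
theorem IsCorankOnePair.mul_eq_zero_iff [CharZero K] (hf : f.IsHomogeneous 3) (hn : 3 ≤ n)
    (h : IsCorankOnePair f y z) (r : ApolarAlgebra f) :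
    y * r = 0 ↔ r ∈ Ideal.span {z} := by
  have hz0 := h.symm.left_ne_zero hn
  have hy0 := h.left_ne_zero hn
  rw [Ideal.mem_span_singleton']
  constructor
  · intro hr
    obtain ⟨c, w, hw, q, hq, s, hs, rfl⟩ := exists_cubic_decomposition hf r
    have hys : y * s = 0 :=
      apolarGrading_eq_zero hf (by norm_num) (mul_mem_apolarGrading h.left_mem hs)
    obtain ⟨-, h1, h2, h3⟩ := cubic_decomposition_unique hf (zero_mem _)
      (mul_mem_apolarGrading h.left_mem (algebraMap_mem_apolarGrading f c))
      (mul_mem_apolarGrading h.left_mem hw) (mul_mem_apolarGrading h.left_mem hq) (by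
        linear_combination hr - hys)
    have hc : c = 0 := by
      by_contra hc
      rw [mul_comm, ← Algebra.smul_def] at h1
      exact hy0 ((smul_eq_zero.1 h1).resolve_left hc)
    obtain ⟨v, rfl⟩ := exists_apolarLinear_eq hw
    obtain ⟨z₀, hz₀⟩ := exists_apolarLinear_eq h.right_mem
    obtain ⟨k, rfl⟩ := exists_smul_eq_of_mul_eq_zero hz0 h.symm.mul_eq_zero h.left_rank
      h2 hz₀
    obtain ⟨w', hw', rfl⟩ := exists_mul_eq_of_apolarForm_mul_eq_zero hf h.right_mem h.left_mem
      hy0 h.symm.mul_eq_zero h.right_rank hq (by rw [h3, map_zero])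
    obtain ⟨q', hq', rfl⟩ := apolarGrading_three_le hf h.right_mem hz0 hs
    refine ⟨algebraMap K _ k + w' + q', ?_⟩
    rw [hc, map_zero, map_smul, hz₀, apolarAlgebra_smul_def]
    ring
  · rintro ⟨a, rfl⟩
    rw [mul_left_comm, h.mul_eq_zero, mul_zero]

/-- yR_1 is a hyperplane of R_2 with equation λ(z ·) = 0. A second form v, not proportional to y, is
not killed by z, so λ(zvb) ≠ 0 for some linear b, and vb supplies the missing dimension.
Independence is phrased on coordinate vectors, so injectivity of `apolarLinear` is never needed. -/
theorem IsCorankOnePair.apolarGrading_two_le [CharZero K] (hf : f.IsHomogeneous 3) (hn : 3 ≤ n)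
    (h : IsCorankOnePair f y z) {I : Ideal (ApolarAlgebra f)} (hy : y ∈ I) {v v₀ : Fin n → K}
    (hv₀ : apolarLinear f v₀ = y) (hv : apolarLinear f v ∈ I) (hne : ∀ c : K, v ≠ c • v₀)
    {q : ApolarAlgebra f} (hq : q ∈ apolarGrading f 2) : q ∈ I := by
  have hz0 := h.symm.left_ne_zero hn
  have hy0 := h.left_ne_zero hn
  have hzv : z * apolarLinear f v ≠ 0 := by
    intro h0
    obtain ⟨c, hc⟩ := exists_smul_eq_of_mul_eq_zero hy0 h.mul_eq_zero h.right_rank h0 hv₀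
    exact hne c hc
  obtain ⟨b, hb, hb0⟩ := exists_apolarForm_mul_ne_zero (d := 2) (e := 1) hf
    (mul_mem_apolarGrading h.right_mem (apolarLinear_mem v)) hzv
  set t : K := apolarForm f (z * q) / apolarForm f (z * apolarLinear f v * b)
  have hm : apolarLinear f v * b ∈ apolarGrading f 2 := mul_mem_apolarGrading (apolarLinear_mem v) hb
  obtain ⟨w, -, hw⟩ := exists_mul_eq_of_apolarForm_mul_eq_zero hf h.left_mem h.right_mem hz0
    h.mul_eq_zero h.left_rank (sub_mem hq (Submodule.smul_mem _ t hm)) (by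
      rw [mul_sub, map_sub, mul_smul_comm, map_smul, smul_eq_mul, ← mul_assoc,
        div_mul_cancel₀ _ hb0, sub_self])
  rw [sub_eq_iff_eq_add.1 hw, apolarAlgebra_smul_def]
  exact add_mem (Ideal.mul_mem_right _ _ hy)
    (Ideal.mul_mem_left _ _ (Ideal.mul_mem_right _ _ hv))

end ExactPair

/-! ### Ideals of linear forms and the Koszul filtration -/

section LinearIdeals

variable {K : Type*} [Field K] {n : ℕ} {f : MvPolynomial (Fin n) K}

theorem exists_of_mem_span_linear [CharZero K] (hf : f.IsHomogeneous 3)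
    {U : Submodule K (ApolarAlgebra f)} (hU : U ≤ apolarGrading f 1) {x : ApolarAlgebra f}
    (hx : x ∈ Ideal.span (U : Set (ApolarAlgebra f))) :
    ∃ u ∈ U, ∃ q ∈ apolarGrading f 2, ∃ s ∈ apolarGrading f 3, x = u + q + s := by
  induction hx using Submodule.span_induction with
  | mem u hu => exact ⟨u, hu, 0, zero_mem _, 0, zero_mem _, by simp⟩
  | zero => exact ⟨0, zero_mem _, 0, zero_mem _, 0, zero_mem _, by simp⟩
  | add a b _ _ ha hb =>
    obtain ⟨u, hu, q, hq, s, hs, rfl⟩ := ha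
    obtain ⟨u', hu', q', hq', s', hs', rfl⟩ := hb
    exact ⟨_, add_mem hu hu', _, add_mem hq hq', _, add_mem hs hs', by ring⟩
  | smul r x _ hx =>
    obtain ⟨u, hu, q, hq, s, hs, rfl⟩ := hx
    obtain ⟨c, r₁, hr₁, r₂, hr₂, r₃, hr₃, rfl⟩ := exists_cubic_decomposition hf r
    have hc := algebraMap_mem_apolarGrading f c
    have hu1 := hU hu
    have z : ∀ {d e : ℕ} {a b : ApolarAlgebra f}, 3 < d + e → a ∈ apolarGrading f d →
      b ∈ apolarGrading f e → a * b = 0 := fun hde ha hb =>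
        apolarGrading_eq_zero hf hde (mul_mem_apolarGrading ha hb)
    refine ⟨c • u, Submodule.smul_mem _ _ hu, algebraMap K _ c * q + r₁ * u,
      add_mem (by simpa using mul_mem_apolarGrading hc hq) (mul_mem_apolarGrading hr₁ hu1),
      algebraMap K _ c * s + r₁ * q + r₂ * u,
      add_mem (add_mem (by simpa using mul_mem_apolarGrading hc hs) (mul_mem_apolarGrading hr₁ hq))
        (mul_mem_apolarGrading hr₂ hu1), ?_⟩
    rw [apolarAlgebra_smul_def, smul_eq_mul]
    linear_combination z (by norm_num) hr₁ hs + z (by norm_num) hr₂ hq + z (by norm_num) hr₂ hs +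
      z (by norm_num) hr₃ hu1 + z (by norm_num) hr₃ hq + z (by norm_num) hr₃ hs

theorem mem_of_mem_span_linear [CharZero K] (hf : f.IsHomogeneous 3)
    {U : Submodule K (ApolarAlgebra f)} (hU : U ≤ apolarGrading f 1) {x : ApolarAlgebra f}
    (hx1 : x ∈ apolarGrading f 1)
    (hx : x ∈ Ideal.span (U : Set (ApolarAlgebra f))) : x ∈ U := by
  obtain ⟨u, hu, q, hq, s, hs, h⟩ := exists_of_mem_span_linear hf hU hx
  obtain ⟨-, h1, -, -⟩ := cubic_decomposition_unique hf (zero_mem _) (sub_mem hx1 (hU hu))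
    (neg_mem hq) (neg_mem hs) (by rw [h]; ring)
  rwa [sub_eq_zero.1 h1]

variable {y z : ApolarAlgebra f}

/-- The linear forms `w` with `w a ∈ I`. -/
noncomputable def linearColon (I : Ideal (ApolarAlgebra f)) (a : ApolarAlgebra f) :
    Submodule K (ApolarAlgebra f) :=
  apolarGrading f 1 ⊓ (I.restrictScalars K).comap (LinearMap.mulRight K a)

/-- The linear forms in the colon include y and another independent form, so they already generate
R_2 and R_3. Only degrees 0 and 1 remain: degree 0 contributes nothing because a ∉ U, and degree 1
is `linearColon` by definition. -/
theorem IsCorankOnePair.colon_eq_span [CharZero K] (hf : f.IsHomogeneous 3) (hn : 3 ≤ n)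
    (h : IsCorankOnePair f y z) {U : Submodule K (ApolarAlgebra f)} (hU : U ≤ apolarGrading f 1)
    (hy : y ∈ U) {a : ApolarAlgebra f} (ha : a ∈ apolarGrading f 1) (haU : a ∉ U)
    (r : ApolarAlgebra f) :
    r * a ∈ Ideal.span (U : Set (ApolarAlgebra f)) ↔
      r ∈ Ideal.span (linearColon (Ideal.span (U : Set (ApolarAlgebra f))) a :
        Set (ApolarAlgebra f)) := by
  have hy0 := h.left_ne_zero hn
  have hz0 := h.symm.left_ne_zero hn
  set J := Ideal.span (U : Set (ApolarAlgebra f)) with hJ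
  have hyJ : y ∈ J := Ideal.subset_span hy
  set W := linearColon J a with hW
  have memW : ∀ w, w ∈ W ↔ w ∈ apolarGrading f 1 ∧ w * a ∈ J := fun w => Iff.rfl
  have hyW : y ∈ W := (memW y).2 ⟨h.left_mem, Ideal.mul_mem_right _ _ hyJ⟩
  have h3 : ∀ {I : Ideal (ApolarAlgebra f)}, y ∈ I → ∀ s ∈ apolarGrading f 3, s ∈ I := by
    intro I hI s hs
    obtain ⟨q, -, rfl⟩ := apolarGrading_three_le hf h.left_mem hy0 hs
    exact Ideal.mul_mem_right _ _ hI
  obtain ⟨y₀, hy₀⟩ := exists_apolarLinear_eq h.left_mem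
  have hex : ∃ v : Fin n → K, apolarLinear f v ∈ W ∧ ∀ c : K, v ≠ c • y₀ := by
    let φ : (Fin n → K) →ₗ[K] K :=
      apolarForm f ∘ₗ LinearMap.mulLeft K (z * a) ∘ₗ apolarLinear f
    -- The kernel of one functional has dimension at least n - 1 ≥ 2. Each v in it has λ(zva) = 0,
    -- so va ∈ yR_1 ⊆ J; hence the colon contains more than the line of y.
    have hd : 1 < Module.finrank K (LinearMap.ker φ) := by
      have h1 := LinearMap.finrank_range_add_finrank_ker φ
      have h2 := Submodule.finrank_le (LinearMap.range φ)
      rw [Module.finrank_self] at h2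
      rw [Module.finrank_fin_fun] at h1
      omega
    by_contra! hcon
    have hle : LinearMap.ker φ ≤ Submodule.span K {y₀} := by
      intro v hv
      have hv' : apolarForm f (z * a * apolarLinear f v) = 0 := hv
      obtain ⟨w, -, hw⟩ := exists_mul_eq_of_apolarForm_mul_eq_zero hf h.left_mem h.right_mem hz0
        h.mul_eq_zero h.left_rank (q := apolarLinear f v * a)
        (mul_mem_apolarGrading (apolarLinear_mem v) ha) (by rw [← hv']; congr 1; ring)
      obtain ⟨c, hc⟩ := hcon v ((memW _).2 ⟨apolarLinear_mem v, by
        rw [hw]; exact Ideal.mul_mem_right _ _ hyJ⟩)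
      exact Submodule.mem_span_singleton.2 ⟨c, hc.symm⟩
    have := Submodule.finrank_mono hle
    have h4 := finrank_span_le_card (R := K) ({y₀} : Set (Fin n → K))
    simp only [Set.toFinset_singleton, Finset.card_singleton] at h4
    omega
  obtain ⟨v, hvW, hv⟩ := hex
  constructor
  · intro hr
    obtain ⟨c, w, hw, q, hq, s, hs, rfl⟩ := exists_cubic_decomposition hf r
    have hqs : q * a + s * a ∈ J := by
      refine add_mem (h3 hyJ _ (mul_mem_apolarGrading hq ha)) ?_
      rw [apolarGrading_eq_zero hf (by norm_num) (mul_mem_apolarGrading hs ha)]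
      exact zero_mem _
    have hcw : algebraMap K _ c * a + w * a ∈ J := by
      have := sub_mem hr hqs
      ring_nf at this ⊢
      exact this
    obtain ⟨u, hu, q', hq', s', hs', he⟩ := exists_of_mem_span_linear hf hU hcw
    obtain ⟨-, h1, -, -⟩ := cubic_decomposition_unique hf (zero_mem _)
      (sub_mem (Submodule.smul_mem _ c ha) (hU hu))
      (sub_mem (mul_mem_apolarGrading hw ha) hq') (neg_mem hs')
      (by rw [apolarAlgebra_smul_def]; linear_combination he)
    have hc : c = 0 := by
      by_contra hc
      apply haU
      rw [← inv_smul_smul₀ hc a, sub_eq_zero.1 h1]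
      exact Submodule.smul_mem _ _ hu
    rw [hc, map_zero, zero_mul, zero_add] at hcw
    rw [hc, map_zero, zero_add]
    refine add_mem (add_mem (Ideal.subset_span ((memW w).2 ⟨hw, hcw⟩)) ?_)
      (h3 (Ideal.subset_span hyW) s hs)
    exact h.apolarGrading_two_le hf hn (Ideal.subset_span hyW) hy₀ (Ideal.subset_span hvW) hv hq
  · intro hr
    have hle : Ideal.span (W : Set (ApolarAlgebra f)) ≤ Submodule.colon J {a} :=
      Ideal.span_le.2 fun w hw => Submodule.mem_colon_singleton.2 ((memW w).1 hw).2
    exact Submodule.mem_colon_singleton.1 (hle hr)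

theorem colon_sup_span_singleton {R : Type*} [CommRing R] (J : Ideal R) (a r : R) :
    r ∈ Submodule.colon J ((J ⊔ Ideal.span {a} : Ideal R) : Set R) ↔ r * a ∈ J := by
  rw [Submodule.mem_colon]
  constructor
  · intro h
    exact h a (Ideal.mem_sup_right (Ideal.mem_span_singleton_self a))
  · intro h s hs
    obtain ⟨j, hj, k, hk, rfl⟩ := Submodule.mem_sup.1 hs
    obtain ⟨t, rfl⟩ := Ideal.mem_span_singleton'.1 hk
    rw [smul_eq_mul, mul_add]
    exact add_mem (Ideal.mul_mem_left _ _ hj) (by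
      rw [mul_left_comm]; exact Ideal.mul_mem_left _ _ h)

/-- The ideals (y) and (z) are handled over 0, each annihilating the other. A larger subspace U is
cut by a functional vanishing at y but not on all of U, and `IsCorankOnePair.colon_eq_span` puts the
colon back into the family. -/
theorem IsCorankOnePair.isKoszulFiltration [CharZero K] (hf : f.IsHomogeneous 3) (hn : 3 ≤ n)
    (h : IsCorankOnePair f y z) :
    IsKoszulFiltration (apolarGrading f) ({⊥, Ideal.span {z}} ∪
      {I | ∃ U : Submodule K (ApolarAlgebra f), U ≤ apolarGrading f 1 ∧ y ∈ U ∧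
        I = Ideal.span (U : Set (ApolarAlgebra f))}) := by
  have hy0 := h.left_ne_zero hn
  have hz0 := h.symm.left_ne_zero hn
  have hspan : ∀ x : ApolarAlgebra f,
      Ideal.span ((Submodule.span K {x} : Submodule K (ApolarAlgebra f)) : Set (ApolarAlgebra f)) =
        Ideal.span {x} := fun x => Submodule.span_span_of_tower K (ApolarAlgebra f) {x}
  have hone : ∀ {a : ApolarAlgebra f}, a ∈ apolarGrading f 1 →
      Submodule.span K {a} ≤ apolarGrading f 1 := fun ha =>
    (Submodule.span_singleton_le_iff_mem _ _).2 ha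
  have hcol : ∀ {a b : ApolarAlgebra f}, IsCorankOnePair f a b →
      Submodule.colon (⊥ : Ideal (ApolarAlgebra f)) (Ideal.span {a} : Ideal (ApolarAlgebra f)) =
        Ideal.span {b} := by
    intro a b hab
    ext r
    rw [← bot_sup_eq (Ideal.span {a}), colon_sup_span_singleton, ← hab.mul_eq_zero_iff hf hn,
      mul_comm, Ideal.mem_bot]
  have hlt : ∀ {a : ApolarAlgebra f}, a ≠ 0 → (⊥ : Ideal (ApolarAlgebra f)) < Ideal.span {a} :=
    fun ha => bot_lt_iff_ne_bot.2 fun h0 => ha (Ideal.span_singleton_eq_bot.1 h0)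
  refine ⟨?_, Or.inl (Or.inl rfl), ?_, ?_⟩
  · rintro I ((rfl | rfl) | ⟨U, hU, -, rfl⟩)
    · exact ⟨∅, Set.empty_subset _, Ideal.span_empty.symm⟩
    · exact ⟨{z}, Set.singleton_subset_iff.2 h.right_mem, rfl⟩
    · exact ⟨U, hU, rfl⟩
  · exact Or.inr ⟨_, le_rfl, h.left_mem, maxHomogeneousIdeal_eq_span f⟩
  · rintro I ((rfl | rfl) | ⟨U, hU, hyU, rfl⟩) hI
    · exact absurd rfl hI
    · refine ⟨⊥, Or.inl (Or.inl rfl), hlt hz0, ⟨z, bot_sup_eq _ |>.symm⟩, ?_⟩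
      rw [hcol h.symm]
      exact Or.inr ⟨_, hone h.left_mem, Submodule.mem_span_singleton_self y, (hspan y).symm⟩
    · by_cases hUy : U = Submodule.span K {y}
      · subst hUy
        rw [hspan]
        refine ⟨⊥, Or.inl (Or.inl rfl), hlt hy0, ⟨y, bot_sup_eq _ |>.symm⟩, ?_⟩
        rw [hcol h]
        exact Or.inl (Or.inr rfl)
      · obtain ⟨a, haU, hay⟩ : ∃ a ∈ U, a ∉ Submodule.span K {y} := by
          by_contra! hcon
          exact hUy (le_antisymm hcon ((Submodule.span_singleton_le_iff_mem _ _).2 hyU))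
        obtain ⟨φ, hφa, hφ⟩ := Submodule.exists_le_ker_of_notMem hay
        have hφy : φ y = 0 := hφ (Submodule.mem_span_singleton_self y)
        set U' := U ⊓ LinearMap.ker φ with hU'
        have hU'1 : U' ≤ apolarGrading f 1 := inf_le_left.trans hU
        have hyU' : y ∈ U' := ⟨hyU, hφy⟩
        have haU' : a ∉ U' := fun h0 => hφa h0.2
        have heq : Ideal.span (U : Set (ApolarAlgebra f)) =
            Ideal.span (U' : Set (ApolarAlgebra f)) ⊔ Ideal.span {a} := by
          refine le_antisymm (Ideal.span_le.2 fun u hu => ?_)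
            (sup_le (Ideal.span_mono fun u hu => hu.1)
              ((Ideal.span_singleton_le_iff_mem _).2 (Ideal.subset_span haU)))
          have h1 : u - (φ u / φ a) • a ∈ U' := by
            refine ⟨sub_mem hu (Submodule.smul_mem _ _ haU), ?_⟩
            change φ _ = 0
            rw [map_sub, map_smul, smul_eq_mul, div_mul_cancel₀ _ hφa, sub_self]
          have h2 : u = (u - (φ u / φ a) • a) + (algebraMap K _ (φ u / φ a)) * a := by
            rw [← Algebra.smul_def, sub_add_cancel]
          rw [h2]
          exact Submodule.add_mem_sup (Ideal.subset_span h1)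
            (Ideal.mul_mem_left _ _ (Ideal.mem_span_singleton_self a))
        refine ⟨Ideal.span (U' : Set (ApolarAlgebra f)), Or.inr ⟨U', hU'1, hyU', rfl⟩, ?_,
          ⟨a, heq⟩, ?_⟩
        · refine lt_of_le_of_ne (Ideal.span_mono fun u hu => hu.1) fun h0 => haU' ?_
          exact mem_of_mem_span_linear hf hU'1 (hU haU) (by rw [h0]; exact Ideal.subset_span haU)
        · refine Or.inr ⟨linearColon (Ideal.span (U' : Set (ApolarAlgebra f))) a, inf_le_left,
            ⟨h.left_mem, Ideal.mul_mem_right _ _ (Ideal.subset_span hyU')⟩, ?_⟩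
          ext r
          rw [heq, colon_sup_span_singleton, h.colon_eq_span hf hn hU'1 hyU' (hU haU) haU']

theorem exists_isKoszulFiltration [CharZero K] (hf : f.IsHomogeneous 3) (hn : 3 ≤ n)
    {y z : MvPolynomial (Fin n) K} (hy : y.IsHomogeneous 1) (hz : z.IsHomogeneous 1)
    (hyz : diffOp (y * z) f = 0) (hyr : quadricRank (diffOp y f) = n - 1)
    (hzr : quadricRank (diffOp z f) = n - 1) :
    ∃ F : Set (Ideal (ApolarAlgebra f)), IsKoszulFiltration (apolarGrading f) F := by
  rw [quadricRank_diffOp] at hyr hzr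
  exact ⟨_, IsCorankOnePair.isKoszulFiltration hf hn (y := Ideal.Quotient.mk _ y)
    (z := Ideal.Quotient.mk _ z) ⟨mk_mem_apolarGrading hy, mk_mem_apolarGrading hz,
      by rw [← map_mul]; exact apolar_mk_eq_zero_iff.2 hyz, by omega, by omega⟩⟩

end LinearIdeals

/-! ### Smooth cubics are not G-quadratic -/

section NotGQuadratic

variable {K : Type*} [Field K] {n : ℕ} {f : MvPolynomial (Fin n) K}

/-- When x_i is the smallest variable, x_i^d is the smallest monomial of degree d, so a form with
this leading monomial has no other term. -/
theorem MonomialOrder.exists_eq_monomial_of_degree_le {m : ℕ} (ord : MonomialOrder.{0, 0} (Fin m))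
    {i : Fin m} (hi : ∀ j, ord.toSyn (Finsupp.single i 1) ≤ ord.toSyn (Finsupp.single j 1))
    {d : ℕ} {g : MvPolynomial (Fin m) K} (hg : g.IsHomogeneous d) (hg0 : g ≠ 0) {e : ℕ}
    (hle : ord.degree g ≤ Finsupp.single i e) :
    ∃ c : K, c ≠ 0 ∧ g = monomial (Finsupp.single i d) c := by
  have hdeg : ord.degree g = Finsupp.single i d := by
    have h1 : ord.degree g = Finsupp.single i (ord.degree g i) := by
      ext j
      by_cases hj : j = i
      · subst hj; simp
      · have := hle j
        rw [Finsupp.single_eq_of_ne hj] at this ⊢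
        omega
    have h2 : (ord.degree g).degree = d :=
      (hg.degree_eq_sum_deg_support (ord.degree_mem_support hg0)).symm
    rw [h1, Finsupp.degree_single] at h2
    rw [h1, h2]
  have hsupp : ∀ a ∈ g.support, a = Finsupp.single i d := by
    intro a ha
    apply ord.toSyn.injective
    refine le_antisymm (hdeg ▸ ord.le_degree ha) ?_
    have had : a.degree = d := (hg.degree_eq_sum_deg_support ha).symm
    have e1 : a = ∑ j, a j • Finsupp.single j 1 := by
      ext k
      rw [Finsupp.finsetSum_apply]
      simp [Finsupp.single_apply]
    have e2 : Finsupp.single i d = ∑ j, a j • Finsupp.single i 1 := by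
      rw [← Finset.sum_smul, ← Finsupp.degree_eq_sum, had, Finsupp.smul_single, smul_eq_mul, mul_one]
    rw [e2]
    conv_rhs => rw [e1]
    rw [map_sum, map_sum]
    refine Finset.sum_le_sum fun j _ => ?_
    rw [map_nsmul, map_nsmul]
    exact nsmul_le_nsmul_right (hi j) _
  refine ⟨coeff (Finsupp.single i d) g, ?_, ?_⟩
  · rw [← hdeg]; exact (ord.coeff_degree_ne_zero_iff).2 hg0
  · ext a
    rw [coeff_monomial]
    split_ifs with h
    · rw [h]
    · by_contra hne
      exact h (hsupp a (mem_support_iff.2 hne)).symm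

/-- R_4 = 0 puts the fourth power of the smallest variable into the ideal; the quadric whose leading
monomial divides it must be a multiple of the square of that variable. -/
theorem exists_sq_eq_zero_of_isGQuadratic [CharZero K] (hf : f.IsHomogeneous 3) (hf0 : f ≠ 0)
    (h : IsGQuadratic (apolarGrading f)) : ∃ a ∈ apolarGrading f 1, a ≠ 0 ∧ a * a = 0 := by
  obtain ⟨m, c, ord, G, hG2, hG, hspan⟩ := h
  -- With no variables R_1 = 0, hence R_3 = R_1^3 = 0; but R_3 pairs nontrivially with 1 ≠ 0.
  have hne : Nonempty (Fin m) := by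
    by_contra hem
    rw [not_nonempty_iff] at hem
    have hbot : apolarGrading f 1 = ⊥ := by
      rw [eq_bot_iff]
      intro a ha
      have := c.ext_elem (x := ⟨a, ha⟩) (y := 0) (fun i => (hem.false i).elim)
      exact congrArg Subtype.val this
    have := apolarAlgebra_nontrivial hf0
    obtain ⟨b, hb, hb0⟩ := exists_apolarForm_mul_ne_zero (d := 0) (e := 3) hf
      (algebraMap_mem_apolarGrading f 1) (by rw [map_one]; exact one_ne_zero)
    rw [← apolarGrading_pow, hbot, Submodule.bot_pow (by norm_num)] at hb
    rw [(Submodule.mem_bot K).1 hb, mul_zero, map_zero] at hb0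
    exact hb0 rfl
  obtain ⟨i, hi⟩ := Finite.exists_min fun j : Fin m => ord.toSyn (Finsupp.single j 1)
  have hX : monomial (Finsupp.single i 4) (1 : K) ∈
      Ideal.span (ord.leadingTerm '' G) := by
    rw [hspan]
    refine Ideal.subset_span ⟨monomial (Finsupp.single i 4) 1, ?_, ord.leadingTerm_monomial _ _⟩
    rw [SetLike.mem_coe, RingHom.mem_ker, ← X_pow_eq_monomial, map_pow, aeval_X]
    refine apolarGrading_eq_zero hf (d := 4) (by norm_num) ?_
    rw [← apolarGrading_pow]
    exact Submodule.pow_mem_pow _ (c i).2 4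
  have hle : Ideal.span (ord.leadingTerm '' G) ≤
      Ideal.span ((fun s => monomial s (1 : K)) '' {s | ∃ g ∈ G, g ≠ 0 ∧ ord.degree g = s}) := by
    refine Ideal.span_le.2 ?_
    rintro _ ⟨g, hg, rfl⟩
    by_cases hg0 : g = 0
    · rw [hg0, ord.leadingTerm_zero]; exact zero_mem _
    · have : ord.leadingTerm g = C (ord.leadingCoeff g) * monomial (ord.degree g) 1 := by
        rw [C_mul_monomial, mul_one]; rfl
      rw [this]
      exact Ideal.mul_mem_left _ _ (Ideal.subset_span ⟨_, ⟨g, hg, hg0, rfl⟩, rfl⟩)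
  obtain ⟨s, ⟨g, hg, hg0, rfl⟩, hs⟩ := mem_ideal_span_monomial_image.1 (hle hX)
    (Finsupp.single i 4) (by rw [mem_support_iff, coeff_monomial, if_pos rfl]; exact one_ne_zero)
  obtain ⟨k, hk, rfl⟩ := ord.exists_eq_monomial_of_degree_le hi (hG2 g hg) hg0 hs
  refine ⟨c i, (c i).2, fun h0 => c.ne_zero i (Subtype.ext h0), ?_⟩
  have hker := hG hg
  rw [SetLike.mem_coe, RingHom.mem_ker, ← mul_one k, ← C_mul_monomial, ← X_pow_eq_monomial,
    map_mul, map_pow, aeval_X, aeval_C, ← Algebra.smul_def] at hker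
  rw [← pow_two]
  exact (smul_eq_zero.1 hker).resolve_left hk

/-- Euler's identity: differentiating in the direction v and evaluating at v. -/
theorem eval_diffOp_linear {g : MvPolynomial (Fin n) K} {d : ℕ} (hg : g.IsHomogeneous d)
    (v : Fin n → K) : eval v (diffOp (∑ i, C (v i) * X i) g) = d * eval v g := by
  have := congrArg (eval v) hg.sum_X_mul_pderiv
  rw [map_nsmul, nsmul_eq_mul] at this
  rw [← this, map_sum, LinearMap.sum_apply, map_sum, map_sum]
  refine Finset.sum_congr rfl fun i _ => ?_
  rw [diffOp_mul_apply, diffOp_X, ← algebraMap_eq, AlgHom.commutes, Module.algebraMap_end_apply,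
    smul_eval, map_mul, eval_X]

theorem isHomogeneous_diffOp_linear {g : MvPolynomial (Fin n) K} {d : ℕ} (hg : g.IsHomogeneous d)
    (v : Fin n → K) : (diffOp (∑ i, C (v i) * X i) g).IsHomogeneous (d - 1) := by
  rw [map_sum, LinearMap.sum_apply]
  refine IsHomogeneous.sum _ _ _ fun i _ => ?_
  rw [diffOp_mul_apply, diffOp_X, ← algebraMap_eq, AlgHom.commutes, Module.algebraMap_end_apply,
    smul_eq_C_mul]
  exact hg.pderiv.C_mul _

/-- If the linear form with coefficients v squares to zero, the second derivative of f along v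
vanishes, hence also that of each quadric ∂f/∂x_i. By Euler the latter is 2(∂f/∂x_i)(v), so v is a
singular point. -/
theorem not_isGQuadratic_of_isSmoothForm [CharZero K] (hf : f.IsHomogeneous 3) (hf0 : f ≠ 0)
    (hs : IsSmoothForm f) : ¬ IsGQuadratic (apolarGrading f) := by
  intro h
  obtain ⟨a, ha, ha0, haa⟩ := exists_sq_eq_zero_of_isGQuadratic hf hf0 h
  obtain ⟨v, rfl⟩ := exists_apolarLinear_eq ha
  have hv0 : v ≠ 0 := by rintro rfl; exact ha0 (map_zero _)
  set l : MvPolynomial (Fin n) K := ∑ i, C (v i) * X i with hl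
  have hmk : apolarLinear f v = Ideal.Quotient.mk _ l := by
    rw [apolarLinear, Fintype.linearCombination_apply, hl, map_sum]
    refine Finset.sum_congr rfl fun i _ => ?_
    rw [map_mul, apolarAlgebra_smul_def]; rfl
  rw [hmk, ← map_mul, apolar_mk_eq_zero_iff] at haa
  have hd : ∀ i, eval v (pderiv i f) = 0 := by
    intro i
    have hq : (pderiv i f).IsHomogeneous 2 := hf.pderiv
    have h0 : diffOp l (diffOp l (pderiv i f)) = 0 := by
      rw [← diffOp_X, ← diffOp_mul_apply, ← diffOp_mul_apply,
        show l * l * X i = X i * (l * l) by ring, diffOp_mul_apply, haa, map_zero]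
    have h1 := eval_diffOp_linear (isHomogeneous_diffOp_linear hq v) v
    rw [← hl, h0, eval_diffOp_linear hq v] at h1
    simpa using h1
  have hfv : eval v f = 0 := by
    have := congrArg (eval v) hf.sum_X_mul_pderiv
    simpa [hd] using this
  have hae : ∀ g : MvPolynomial (Fin n) K,
      aeval (fun i => algebraMap K (AlgebraicClosure K) (v i)) g =
        algebraMap K (AlgebraicClosure K) (eval v g) := fun g => by
    rw [← coe_aeval_eq_eval]
    exact aeval_algebraMap_apply _ v g
  obtain ⟨i, hi⟩ := hs (fun i => algebraMap K (AlgebraicClosure K) (v i)) (fun h => hv0 (by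
    ext i
    have := congrFun h i
    simpa using this)) (by rw [hae, hfv, map_zero])
  exact hi (by rw [hae, hd, map_zero])

end NotGQuadratic

universe u

/-! ### Linear resolutions over a nilpotent ideal -/

section LinearResolution

variable {R : Type u} [CommRing R] (m : Ideal R)

/-- `HasLinearResolution m k X`: the first `k` steps of a minimal free resolution of the `R`-module
`X` are linear, in the sense that each syzygy module `Z ⊆ F` satisfies `Z ≤ m F` and
`Z ⊓ m² F ≤ m Z`. -/
def HasLinearResolution : ℕ → ∀ (X : Type u) [AddCommGroup X] [Module R X], Prop
  | 0, _, _, _ => True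
  | k + 1, X, _, _ => ∃ (F : Type u) (_ : AddCommGroup F) (_ : Module R F) (_ : Module.Free R F)
      (p : F →ₗ[R] X), Function.Surjective p ∧ LinearMap.ker p ≤ m • ⊤ ∧
        LinearMap.ker p ⊓ m ^ 2 • ⊤ ≤ m • LinearMap.ker p ∧
        HasLinearResolution k (LinearMap.ker p)

variable {m}
variable {X Y Z F F' : Type u} [AddCommGroup X] [Module R X] [AddCommGroup Y] [Module R Y]
  [AddCommGroup Z] [Module R Z] [AddCommGroup F] [Module R F] [AddCommGroup F'] [Module R F']

theorem HasLinearResolution.of_equiv (e : X ≃ₗ[R] Y) {k : ℕ} (h : HasLinearResolution m k X) :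
    HasLinearResolution m k Y := by
  cases k with
  | zero => trivial
  | succ k =>
    obtain ⟨F, _, _, hF, p, hp, h1, h2, h3⟩ := h
    refine ⟨F, _, _, hF, e.toLinearMap ∘ₗ p, e.surjective.comp hp, ?_⟩
    rw [LinearEquiv.ker_comp]
    exact ⟨h1, h2, h3⟩

theorem HasLinearResolution.of_subsingleton [Subsingleton X] (k : ℕ) :
    HasLinearResolution m k X := by
  induction k generalizing X with
  | zero => trivial
  | succ k ih =>
    refine ⟨PUnit, inferInstance, inferInstance, inferInstance, 0, fun x => ⟨0, Subsingleton.elim _ _⟩,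
      fun x _ => ?_, fun x _ => ?_, ih⟩
    · rw [Subsingleton.elim x 0]; exact zero_mem _
    · rw [Subsingleton.elim x 0]; exact zero_mem _

theorem Submodule.smul_top_map_le (I : Ideal R) (g : X →ₗ[R] Y) {x : X}
    (hx : x ∈ I • (⊤ : Submodule R X)) : g x ∈ I • (⊤ : Submodule R Y) := by
  have : g x ∈ (I • (⊤ : Submodule R X)).map g := ⟨x, hx, rfl⟩
  rw [Submodule.map_smul''] at this
  exact Submodule.smul_mono (le_refl _) le_top this

/-- Nakayama for a nilpotent ideal, which needs no finite generation; the covers used here may have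
infinite rank. -/
theorem Submodule.eq_top_of_sup_smul_top_eq_top (hm : IsNilpotent m) {N : Submodule R X}
    (h : N ⊔ m • ⊤ = ⊤) : N = ⊤ := by
  have key : ∀ k : ℕ, N ⊔ m ^ k • ⊤ = ⊤ := by
    intro k
    induction k with
    | zero => simp
    | succ k ih =>
      rw [eq_top_iff]
      calc (⊤ : Submodule R X) = N ⊔ m • (N ⊔ m ^ k • ⊤) := by rw [ih, h]
        _ ≤ N ⊔ m ^ (k + 1) • ⊤ := by
          rw [Submodule.smul_sup, ← Submodule.mul_smul, ← pow_succ']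
          exact sup_le le_sup_left (sup_le (Submodule.smul_le_right.trans le_sup_left) le_sup_right)
  obtain ⟨k, hk⟩ := hm
  have := key k
  rwa [hk, Submodule.zero_eq_bot, Submodule.bot_smul, sup_bot_eq] at this

/-- g - id raises m-adic order, so a kernel element lies in every power of m; surjectivity is
Nakayama. -/
theorem LinearMap.bijective_of_sub_mem_smul_top (hm : IsNilpotent m) (g : F →ₗ[R] F)
    (h : ∀ x, g x - x ∈ m • (⊤ : Submodule R F)) : Function.Bijective g := by
  constructor
  · rw [← LinearMap.ker_eq_bot, eq_bot_iff]
    intro x hx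
    have hg : g x = 0 := hx
    have key : ∀ k : ℕ, x ∈ m ^ k • (⊤ : Submodule R F) := by
      have step : ∀ k : ℕ, ∀ y ∈ m ^ k • (⊤ : Submodule R F), g y - y ∈ m ^ (k + 1) • (⊤ : Submodule R F) := by
        intro k y hy
        have : (g - (LinearMap.id : F →ₗ[R] F)) y ∈ (m ^ k • (⊤ : Submodule R F)).map (g - (LinearMap.id : F →ₗ[R] F)) :=
          ⟨y, hy, rfl⟩
        rw [Submodule.map_smul''] at this
        have hle : (⊤ : Submodule R F).map (g - (LinearMap.id : F →ₗ[R] F)) ≤ m • ⊤ := by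
          rintro _ ⟨z, -, rfl⟩; exact h z
        have := Submodule.smul_mono (le_refl (m ^ k)) hle this
        rwa [← Submodule.mul_smul, ← pow_succ] at this
      intro k
      induction k with
      | zero => simp
      | succ k ih =>
        have := step k x ih
        rw [hg, zero_sub] at this
        simpa using neg_mem this
    obtain ⟨k, hk⟩ := hm
    have := key k
    rwa [hk, Submodule.zero_eq_bot, Submodule.bot_smul] at this
  · rw [← LinearMap.range_eq_top]
    apply Submodule.eq_top_of_sup_smul_top_eq_top hm
    rw [eq_top_iff]
    intro x _
    have : x = g x - (g x - x) := by abel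
    rw [this]
    exact sub_mem (Submodule.mem_sup_left ⟨x, rfl⟩) (Submodule.mem_sup_right (h x))

/-- Lift each cover through the other. Both composites differ from the identity by elements of the
kernels, hence by elements of mF and mF', so they are bijective. -/
theorem exists_equiv_of_minimal_covers (hm : IsNilpotent m) [Module.Free R F] [Module.Free R F']
    {p : F →ₗ[R] X} {p' : F' →ₗ[R] X} (hp : Function.Surjective p) (hp' : Function.Surjective p')
    (h : LinearMap.ker p ≤ m • ⊤) (h' : LinearMap.ker p' ≤ m • ⊤) :
    ∃ e : F ≃ₗ[R] F', p' ∘ₗ e.toLinearMap = p := by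
  obtain ⟨a, ha⟩ := Module.projective_lifting_property p' p hp'
  obtain ⟨b, hb⟩ := Module.projective_lifting_property p p' hp
  have hba : Function.Bijective (b ∘ₗ a) := LinearMap.bijective_of_sub_mem_smul_top hm _ fun x =>
    h (by
      rw [LinearMap.mem_ker, map_sub, sub_eq_zero]
      change (p ∘ₗ b) (a x) = p x
      rw [hb]; exact LinearMap.congr_fun ha x)
  have hab : Function.Bijective (a ∘ₗ b) := LinearMap.bijective_of_sub_mem_smul_top hm _ fun x =>
    h' (by
      rw [LinearMap.mem_ker, map_sub, sub_eq_zero]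
      change (p' ∘ₗ a) (b x) = p' x
      rw [ha]; exact LinearMap.congr_fun hb x)
  have hbij : Function.Bijective a :=
    ⟨Function.Injective.of_comp (f := b) hba.1, Function.Surjective.of_comp (g := b) hab.2⟩
  exact ⟨LinearEquiv.ofBijective a hbij, LinearMap.ext fun x => LinearMap.congr_fun ha x⟩

/-- The linearity conditions hold for every minimal cover as soon as they hold for one. -/
theorem HasLinearResolution.of_cover (hm : IsNilpotent m) {k : ℕ}
    (h : HasLinearResolution m (k + 1) X) [Module.Free R F] {p : F →ₗ[R] X}
    (hp : Function.Surjective p) (hpm : LinearMap.ker p ≤ m • ⊤) :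
    LinearMap.ker p ⊓ m ^ 2 • ⊤ ≤ m • LinearMap.ker p ∧
      HasLinearResolution m k (LinearMap.ker p) := by
  obtain ⟨F', _, _, hF', p', hp', h1, h2, h3⟩ := h
  obtain ⟨e, he⟩ := exists_equiv_of_minimal_covers hm hp' hp h1 hpm
  have hker : (LinearMap.ker p').map e.toLinearMap = LinearMap.ker p := by
    rw [← he, LinearMap.ker_comp, Submodule.map_comap_eq, LinearEquiv.range, top_inf_eq]
  constructor
  · rw [← hker, ← Submodule.map_smul'']
    refine le_trans ?_ (Submodule.map_mono h2)
    rw [Submodule.map_inf _ e.injective, Submodule.map_smul'', Submodule.map_top, LinearEquiv.range]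
  · exact h3.of_equiv ((e.submoduleMap _).trans (LinearEquiv.ofEq _ _ hker))

theorem Submodule.mem_smul_top_prod (I : Ideal R) {x : X × Y} :
    x ∈ I • (⊤ : Submodule R (X × Y)) ↔
      x.1 ∈ I • (⊤ : Submodule R X) ∧ x.2 ∈ I • (⊤ : Submodule R Y) := by
  constructor
  · intro h
    exact ⟨Submodule.smul_top_map_le I (LinearMap.fst R X Y) h,
      Submodule.smul_top_map_le I (LinearMap.snd R X Y) h⟩
  · rintro ⟨h1, h2⟩
    have : x = LinearMap.inl R X Y x.1 + LinearMap.inr R X Y x.2 := by ext <;> simp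
    rw [this]
    exact add_mem (Submodule.smul_top_map_le I _ h1) (Submodule.smul_top_map_le I _ h2)

theorem Submodule.exists_mem_smul_of_map {I : Ideal R} (g : X →ₗ[R] Y) {N : Submodule R X}
    {N' : Submodule R Y} (hN : N' ≤ N.map g) {y : Y} (hy : y ∈ I • N') :
    ∃ x ∈ I • N, g x = y := by
  have := Submodule.smul_mono (le_refl I) hN hy
  rw [← Submodule.map_smul''] at this
  exact this

/-- The class of modules with linear resolutions is closed under extensions `0 → X → Y → Z → 0`
with `X ∩ mY = mX`. -/
theorem HasLinearResolution.of_extension {k : ℕ} {i : X →ₗ[R] Y} {q : Y →ₗ[R] Z}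
    (hi : Function.Injective i) (hq : Function.Surjective q)
    (hex : LinearMap.range i = LinearMap.ker q)
    (hpure : ∀ x, i x ∈ m • (⊤ : Submodule R Y) → x ∈ m • (⊤ : Submodule R X))
    (hX : HasLinearResolution m k X) (hZ : HasLinearResolution m k Z) :
    HasLinearResolution m k Y := by
  induction k generalizing X Y Z with
  | zero => trivial
  | succ k ih =>
    obtain ⟨F, _, _, hF, p, hp, h1, h2, h3⟩ := hX
    obtain ⟨F', _, _, hF', p', hp', h1', h2', h3'⟩ := hZ
    obtain ⟨s, hs⟩ := Module.projective_lifting_property q p' hq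
    have hs' : ∀ b, q (s b) = p' b := fun b => LinearMap.congr_fun hs b
    have hqi : ∀ x, q (i x) = 0 := fun x => by
      have : i x ∈ LinearMap.ker q := hex ▸ ⟨x, rfl⟩
      exact this
    -- The horseshoe construction: cover Y by the sum of the covers of X and Z.
    let P : F × F' →ₗ[R] Y := (i ∘ₗ p).coprod s
    have hP : ∀ a b, P (a, b) = i (p a) + s b := fun a b => rfl
    have hker2 : ∀ {x : F × F'}, x ∈ LinearMap.ker P → x.2 ∈ LinearMap.ker p' := by
      rintro ⟨a, b⟩ h
      have h' : i (p a) + s b = 0 := h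
      have := congrArg q h'
      rw [map_add, hqi, zero_add, hs', map_zero] at this
      exact this
    have hlift : ∀ b ∈ LinearMap.ker p', ∃ a, (a, b) ∈ LinearMap.ker P := by
      intro b hb
      have : s b ∈ LinearMap.range i := by
        rw [hex, LinearMap.mem_ker, hs']; exact hb
      obtain ⟨x, hx⟩ := this
      obtain ⟨a, rfl⟩ := hp x
      exact ⟨-a, by rw [LinearMap.mem_ker, hP, map_neg, map_neg, hx, neg_add_cancel]⟩
    have hker1 : ∀ a, (a, 0) ∈ LinearMap.ker P ↔ a ∈ LinearMap.ker p := by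
      intro a
      rw [LinearMap.mem_ker, hP, map_zero, add_zero, LinearMap.mem_ker]
      exact ⟨fun h => hi (by rw [h, map_zero]), fun h => by rw [h, map_zero]⟩
    have hmin : LinearMap.ker P ≤ m • ⊤ := by
      rintro ⟨a, b⟩ h
      have hb := h1' (hker2 h)
      rw [Submodule.mem_smul_top_prod]
      refine ⟨?_, hb⟩
      have h' : i (p a) + s b = 0 := h
      -- Minimality of the combined cover is where purity X ∩ mY = mX enters.
      have h4 : p a ∈ m • (⊤ : Submodule R X) := hpure _ (by
        rw [eq_neg_of_add_eq_zero_left h']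
        exact neg_mem (Submodule.smul_top_map_le m s hb))
      obtain ⟨a', ha', hpa⟩ := Submodule.exists_mem_smul_of_map p (N := ⊤) (N' := ⊤)
        (by rw [Submodule.map_top, LinearMap.range_eq_top.2 hp]) h4
      have : a = a' + (a - a') := by abel
      rw [this]
      exact add_mem ha' (h1 (by rw [LinearMap.mem_ker, map_sub, hpa, sub_self]))
    have hsq : m • LinearMap.ker P ≤ m ^ 2 • (⊤ : Submodule R (F × F')) := by
      rw [pow_two, Submodule.mul_smul]; exact Submodule.smul_mono (le_refl m) hmin
    refine ⟨F × F', inferInstance, inferInstance, inferInstance, P, ?_, hmin, ?_, ?_⟩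
    · intro y
      obtain ⟨b, hb⟩ := hp' (q y)
      have : y - s b ∈ LinearMap.range i := by
        rw [hex, LinearMap.mem_ker, map_sub, hs', hb, sub_self]
      obtain ⟨x, hx⟩ := this
      obtain ⟨a, rfl⟩ := hp x
      exact ⟨(a, b), by rw [hP, hx, sub_add_cancel]⟩
    · rintro x ⟨hx, hx2⟩
      have hb : x.2 ∈ m • LinearMap.ker p' :=
        h2' ⟨hker2 hx, ((Submodule.mem_smul_top_prod _).1 hx2).2⟩
      obtain ⟨w, hw, hwx⟩ := Submodule.exists_mem_smul_of_map (LinearMap.snd R F F')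
        (N := LinearMap.ker P) (fun b hb => by
          obtain ⟨a, ha⟩ := hlift b hb
          exact ⟨(a, b), ha, rfl⟩) hb
      have hd : x - w = LinearMap.inl R F F' (x - w).1 := by
        ext
        · rfl
        · simp only [Prod.snd_sub, LinearMap.inl_apply, sub_eq_zero]
          exact hwx.symm
      have hdm : (x - w).1 ∈ m • LinearMap.ker p := by
        refine h2 ⟨(hker1 _).1 ?_, ((Submodule.mem_smul_top_prod _).1 (sub_mem hx2 (hsq hw))).1⟩
        have := sub_mem hx (Submodule.smul_le_right hw)
        rw [hd] at this
        exact this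
      have : x = w + LinearMap.inl R F F' (x - w).1 := by rw [← hd]; abel
      rw [this]
      refine add_mem hw ?_
      have h5 : LinearMap.inl R F F' (x - w).1 ∈
        (m • LinearMap.ker p).map (LinearMap.inl R F F') := ⟨_, hdm, rfl⟩
      rw [Submodule.map_smul''] at h5
      refine Submodule.smul_mono (le_refl m) ?_ h5
      rintro _ ⟨a, ha, rfl⟩
      exact (hker1 a).2 ha
    · let j : LinearMap.ker p →ₗ[R] LinearMap.ker P :=
        ((LinearMap.inl R F F').comp (LinearMap.ker p).subtype).codRestrict _
          fun a => (hker1 a).2 a.2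
      let r : LinearMap.ker P →ₗ[R] LinearMap.ker p' :=
        ((LinearMap.snd R F F').comp (LinearMap.ker P).subtype).codRestrict _
          fun x => hker2 x.2
      refine ih (i := j) (q := r) ?_ ?_ ?_ ?_ h3 h3'
      · intro a b hab
        have := congrArg (fun x : LinearMap.ker P => x.1.1) hab
        exact Subtype.ext this
      · rintro ⟨b, hb⟩
        obtain ⟨a, ha⟩ := hlift b hb
        exact ⟨⟨(a, b), ha⟩, rfl⟩
      · ext ⟨⟨a, b⟩, hx⟩
        constructor
        · rintro ⟨c, hc⟩
          have := congrArg (fun x : LinearMap.ker P => x.1.2) hc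
          exact Subtype.ext this.symm
        · intro h
          have hb : b = 0 := congrArg Subtype.val h
          subst hb
          exact ⟨⟨a, (hker1 a).1 hx⟩, rfl⟩
      -- Purity is inherited by the syzygies: an element of ker p in m ker P lies in m²F, and
      -- linearity of the resolution of X puts it into m ker p.
      · rintro ⟨a, ha⟩ h
        have h6 := Submodule.mem_map_of_mem (f := (LinearMap.ker P).subtype) h
        rw [Submodule.map_smul'', Submodule.map_subtype_top] at h6
        have h7 := ((Submodule.mem_smul_top_prod _).1 (hsq h6)).1
        have h8 : a ∈ m • LinearMap.ker p := h2 ⟨ha, h7⟩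
        rwa [Submodule.mem_smul_top_iff]

end LinearResolution

/-! ### Minimal covers and direct summands -/

section Retract

variable {R : Type u} [CommRing R] {m : Ideal R}

/-- Lift a vector space basis of X/mX: it generates X by Nakayama, and any relation has coefficients
in m because the basis is independent modulo m. -/
theorem exists_minimal_cover (hm : IsNilpotent m) [hmax : m.IsMaximal] (X : Type u) [AddCommGroup X]
    [Module R X] : ∃ (F : Type u) (_ : AddCommGroup F) (_ : Module R F) (_ : Module.Free R F)
      (p : F →ₗ[R] X), Function.Surjective p ∧ LinearMap.ker p ≤ m • ⊤ := by
  let _ := Ideal.Quotient.field m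
  let b := Module.Basis.ofVectorSpace (R ⧸ m) (X ⧸ (m • ⊤ : Submodule R X))
  choose x hx using fun i => Submodule.mkQ_surjective (m • ⊤ : Submodule R X) (b i)
  refine ⟨_ →₀ R, inferInstance, inferInstance, inferInstance, Finsupp.linearCombination R x, ?_, ?_⟩
  · rw [← LinearMap.range_eq_top]
    apply Submodule.eq_top_of_sup_smul_top_eq_top hm
    rw [eq_top_iff]
    intro y _
    have key : ∀ z : X ⧸ (m • ⊤ : Submodule R X),
        ∃ w ∈ LinearMap.range (Finsupp.linearCombination R x), Submodule.mkQ (m • ⊤) w = z := by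
      intro z
      induction b.mem_span z using Submodule.span_induction with
      | zero => exact ⟨0, zero_mem _, map_zero _⟩
      | mem z h =>
        obtain ⟨i, rfl⟩ := h
        exact ⟨x i, ⟨Finsupp.single i 1, by simp⟩, hx i⟩
      | add z z' _ _ h h' =>
        obtain ⟨w, hw, rfl⟩ := h
        obtain ⟨w', hw', rfl⟩ := h'
        exact ⟨w + w', add_mem hw hw', map_add _ _ _⟩
      | smul c z _ h =>
        obtain ⟨w, hw, rfl⟩ := h
        obtain ⟨r, rfl⟩ := Ideal.Quotient.mk_surjective c
        exact ⟨r • w, Submodule.smul_mem _ _ hw, rfl⟩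
    obtain ⟨w, hw, hwy⟩ := key (Submodule.mkQ _ y)
    have : y = w + (y - w) := by abel
    rw [this]
    refine add_mem (Submodule.mem_sup_left hw) (Submodule.mem_sup_right ?_)
    rw [← Submodule.ker_mkQ (m • ⊤ : Submodule R X), LinearMap.mem_ker, map_sub, hwy, sub_self]
  · intro c hc
    have hc' : Finsupp.linearCombination R x c = 0 := hc
    have h1 : Finsupp.linearCombination (R ⧸ m) b
        (c.mapRange (Ideal.Quotient.mk m) (map_zero _)) = 0 := by
      have := congrArg (Submodule.mkQ (m • ⊤ : Submodule R X)) hc'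
      rw [Finsupp.linearCombination_apply, Finsupp.sum, map_sum, map_zero] at this
      have h0 : (c.mapRange (Ideal.Quotient.mk m) (map_zero _)).sum (fun i r => r • b i) =
          c.sum fun i r => Ideal.Quotient.mk m r • b i :=
        Finsupp.sum_mapRange_index fun i => zero_smul _ _
      rw [Finsupp.linearCombination_apply, h0, Finsupp.sum, ← this]
      refine Finset.sum_congr rfl fun i _ => ?_
      rw [← hx i]; rfl
    have h2 := (linearIndependent_iff.1 b.linearIndependent) _ h1
    rw [← c.sum_single]
    refine Submodule.sum_mem _ fun i _ => ?_
    have h3 : c i ∈ m := by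
      have := DFunLike.congr_fun h2 i
      rw [Finsupp.mapRange_apply] at this
      exact Ideal.Quotient.eq_zero_iff_mem.1 this
    have : Finsupp.single i (c i) = c i • Finsupp.single i (1 : R) := by simp
    rw [this]
    exact Submodule.smul_mem_smul h3 trivial

/-- Minimal covers of the summand X and of its complement ker p add up to a minimal cover of Y. Its
kernel has the syzygies of X as a retract, so linearity passes to X inductively. -/
theorem HasLinearResolution.of_retract (hm : IsNilpotent m) [m.IsMaximal] {k : ℕ} {X Y : Type u}
    [AddCommGroup X] [Module R X] [AddCommGroup Y] [Module R Y] {i : X →ₗ[R] Y} {p : Y →ₗ[R] X}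
    (hpi : ∀ x, p (i x) = x) (hY : HasLinearResolution m k Y) : HasLinearResolution m k X := by
  induction k generalizing X Y with
  | zero => trivial
  | succ k ih =>
    obtain ⟨A, _, _, _, a, ha, ham⟩ := exists_minimal_cover hm X
    obtain ⟨C, _, _, _, c, hc, hcm⟩ := exists_minimal_cover hm (LinearMap.ker p)
    let P : A × C →ₗ[R] Y := (i ∘ₗ a).coprod ((LinearMap.ker p).subtype ∘ₗ c)
    have hP : ∀ x z, P (x, z) = i (a x) + c z := fun _ _ => rfl
    have hpc : ∀ z, p (c z) = 0 := fun z => (c z).2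
    have hker : ∀ {x z}, (x, z) ∈ LinearMap.ker P → a x = 0 ∧ c z = 0 := by
      intro x z h
      rw [LinearMap.mem_ker, hP] at h
      have h1 := congrArg p h
      rw [map_add, hpi, hpc, add_zero, map_zero] at h1
      rw [h1, map_zero, zero_add] at h
      exact ⟨h1, Subtype.ext h⟩
    have hPs : Function.Surjective P := by
      intro y
      obtain ⟨x, hx⟩ := ha (p y)
      obtain ⟨z, hz⟩ := hc ⟨y - i (p y), by rw [LinearMap.mem_ker, map_sub, hpi, sub_self]⟩
      exact ⟨(x, z), by rw [hP, hx, hz]; exact add_sub_cancel _ _⟩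
    obtain ⟨h1, h2⟩ := hY.of_cover hm hPs (by
      rintro ⟨x, z⟩ h
      exact (Submodule.mem_smul_top_prod _).2 ⟨ham (hker h).1, hcm (hker h).2⟩)
    have hinl : ∀ x ∈ LinearMap.ker a, LinearMap.inl R A C x ∈ LinearMap.ker P := by
      intro x hx
      have hx' : a x = 0 := hx
      rw [LinearMap.mem_ker, LinearMap.inl_apply, hP, hx', map_zero, map_zero, zero_add]
      rfl
    refine ⟨A, _, _, ‹_›, a, ha, ham, ?_, ?_⟩
    · rintro x ⟨hx, hx2⟩
      have h3 := h1 ⟨hinl x hx, Submodule.smul_top_map_le _ (LinearMap.inl R A C) hx2⟩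
      have h4 : x ∈ (m • LinearMap.ker P).map (LinearMap.fst R A C) := ⟨_, h3, rfl⟩
      rw [Submodule.map_smul''] at h4
      refine Submodule.smul_mono (le_refl m) ?_ h4
      rintro _ ⟨⟨x, z⟩, h, rfl⟩
      exact (hker h).1
    · exact ih (i := ((LinearMap.inl R A C).comp (LinearMap.ker a).subtype).codRestrict
          (LinearMap.ker P) fun x => hinl x x.2)
        (p := ((LinearMap.fst R A C).comp (LinearMap.ker P).subtype).codRestrict
          (LinearMap.ker a) fun x => (hker x.2).1) (fun x => rfl) h2

end Retract

/-! ### Linear resolutions from a filtration of ideals -/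

section Filtration

variable {R B : Type u} [CommRing R] [CommRing B] [Algebra R B] {m : Ideal R}

theorem mem_smul_top_ideal_iff (I : Ideal B) (x : I) :
    x ∈ m • (⊤ : Submodule R I) ↔ (x : B) ∈ m.map (algebraMap R B) * I := by
  have h := Submodule.mem_smul_top_iff m (I.restrictScalars R) x
  have h2 := Ideal.smul_restrictScalars (S := B) (M := B) m I
  rw [← h2] at h
  exact h

/-- The modules B/I are resolved over R, not over B. Since B is R-free, the first syzygy of B/I is
I. For I ≠ 0 in the filtration, 0 → J → I → B/(J : I) → 0 is pure, so I is handled by induction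
along ideals inside the induction on length. -/
theorem hasLinearResolution_of_filtration [Module.Free R B] [IsArtinianRing B]
    {F : Set (Ideal B)}
    (h1 : ∀ I ∈ F, I ≤ m.map (algebraMap R B))
    (h2 : ∀ I ∈ F, I ⊓ m.map (algebraMap R B) ^ 2 ≤ m.map (algebraMap R B) * I)
    (h3 : ∀ I ∈ F, I ≠ ⊥ → ∃ J ∈ F, J < I ∧ (∃ a, I = J ⊔ Ideal.span {a}) ∧
      Submodule.colon J (I : Set B) ∈ F) (k : ℕ) :
    ∀ I ∈ F, HasLinearResolution m k (B ⧸ I) := by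
  induction k with
  | zero => exact fun I _ => trivial
  | succ k ih =>
    have hideal : ∀ I : Ideal B, I ∈ F → HasLinearResolution m k I := by
      intro I
      induction I using WellFoundedLT.induction with
      | ind I hI =>
        intro hIF
        by_cases hI0 : I = ⊥
        · subst hI0; exact HasLinearResolution.of_subsingleton k
        obtain ⟨J, hJ, hJI, ⟨a, ha⟩, hcol⟩ := h3 I hIF hI0
        have haI : a ∈ I := ha ▸ Ideal.mem_sup_right (Ideal.mem_span_singleton_self a)
        let J' : Submodule B I := Submodule.comap I.subtype J
        let g : B →ₗ[B] I ⧸ J' := J'.mkQ ∘ₗ LinearMap.toSpanSingleton B I ⟨a, haI⟩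
        have hg : Function.Surjective g := by
          intro y
          obtain ⟨⟨x, hx⟩, rfl⟩ := J'.mkQ_surjective y
          have hx' := hx
          rw [ha] at hx'
          obtain ⟨j, hj, c, hc, hjc⟩ := Submodule.mem_sup.1 hx'
          obtain ⟨t, rfl⟩ := Ideal.mem_span_singleton'.1 hc
          refine ⟨t, ?_⟩
          change Submodule.Quotient.mk _ = Submodule.Quotient.mk _
          rw [Submodule.Quotient.eq]
          change t * a - x ∈ J
          rw [← hjc, sub_add_cancel_right]
          exact neg_mem hj
        have hker : LinearMap.ker g = Submodule.colon J (I : Set B) := by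
          ext t
          have : t ∈ LinearMap.ker g ↔ t * a ∈ J := by
            rw [LinearMap.mem_ker]
            change Submodule.Quotient.mk _ = 0 ↔ _
            rw [Submodule.Quotient.mk_eq_zero]
            rfl
          rw [this, ha, Submodule.mem_colon]
          constructor
          · intro h s hs
            obtain ⟨j, hj, c, hc, rfl⟩ := Submodule.mem_sup.1 hs
            obtain ⟨r, rfl⟩ := Ideal.mem_span_singleton'.1 hc
            rw [smul_eq_mul, mul_add]
            exact add_mem (Ideal.mul_mem_left _ _ hj) (by
              rw [mul_left_comm]; exact Ideal.mul_mem_left _ _ h)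
          · intro h
            exact h a (Ideal.mem_sup_right (Ideal.mem_span_singleton_self a))
        have hZ : HasLinearResolution m k (I ⧸ J') :=
          (ih _ hcol).of_equiv (((Submodule.quotEquivOfEq _ _ hker.symm).trans
            (g.quotKerEquivOfSurjective hg)).restrictScalars R)
        refine HasLinearResolution.of_extension
          (i := (Submodule.inclusion hJI.le).restrictScalars R)
          (q := J'.mkQ.restrictScalars R) (Submodule.inclusion_injective hJI.le) J'.mkQ_surjective
          ?_ ?_ (hI J hJI hJ) hZ
        · ext x
          change (∃ y, _) ↔ Submodule.Quotient.mk _ = 0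
          rw [Submodule.Quotient.mk_eq_zero]
          constructor
          · rintro ⟨y, rfl⟩; exact y.2
          · intro hx; exact ⟨⟨x, hx⟩, rfl⟩
        -- Purity: an element of J lying in mI is in m², and J ∩ m² ≤ mJ since J belongs to the
        -- filtration.
        · intro x hx
          rw [mem_smul_top_ideal_iff] at hx ⊢
          refine h2 J hJ ⟨x.2, ?_⟩
          rw [pow_two]
          exact Ideal.mul_mono_right (h1 I hIF) hx
    intro I hIF
    have hk : LinearMap.ker ((Submodule.mkQ I).restrictScalars R) = I.restrictScalars R := by
      rw [LinearMap.ker_restrictScalars, Submodule.ker_mkQ]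
    have hmap : ∀ a : Ideal R, (a • ⊤ : Submodule R B) =
        (a.map (algebraMap R B)).restrictScalars R := fun a => Ideal.smul_top_eq_map a
    refine ⟨B, inferInstance, inferInstance, inferInstance, (Submodule.mkQ I).restrictScalars R,
      Submodule.mkQ_surjective I, ?_, ?_, ?_⟩
    · rw [hk, hmap]; exact h1 I hIF
    · rw [hk, hmap, Ideal.map_pow, ← Ideal.smul_restrictScalars]
      exact h2 I hIF
    · rw [hk]
      exact hideal I hIF

end Filtration

/-! ### From linear resolutions to matrices of linear forms -/

section KoszulOfLinear

variable {K : Type*} {R : Type u} [Field K] [CommRing R] [Algebra K R]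

theorem Submodule.mem_smul_top_pi_iff {b : ℕ} (I : Ideal R) (v : Fin b → R) :
    v ∈ I • (⊤ : Submodule R (Fin b → R)) ↔ ∀ j, v j ∈ I := by
  constructor
  · intro h j
    have := Submodule.smul_top_map_le I (LinearMap.proj (R := R) (φ := fun _ : Fin b => R) j) h
    rwa [smul_eq_mul, Ideal.mul_top] at this
  · intro h
    rw [pi_eq_sum_univ' v]
    exact Submodule.sum_mem _ fun j _ => Submodule.smul_mem_smul (h j) trivial

/-- The properties of the grading used to build a linear resolution. -/
structure IsLinearGrading (𝒜 : ℕ → Submodule K R) : Prop where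
  nilpotent : IsNilpotent (maxHomogeneousIdeal 𝒜)
  ne_top : maxHomogeneousIdeal 𝒜 ≠ ⊤
  exists_decomp : ∀ r : R, ∃ c : K, ∃ a ∈ 𝒜 1, ∃ q ∈ maxHomogeneousIdeal 𝒜 ^ 2,
    r = algebraMap K R c + a + q
  mul_mem : ∀ a ∈ 𝒜 1, ∀ b ∈ 𝒜 1, a * b ∈ 𝒜 2
  one_inf : ∀ a ∈ 𝒜 1, a ∈ maxHomogeneousIdeal 𝒜 ^ 2 → a = 0
  two_inf : ∀ a ∈ 𝒜 2, a ∈ maxHomogeneousIdeal 𝒜 ^ 3 → a = 0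

/-- A syzygy module in a linear resolution under construction. -/
structure LinearStage (𝒜 : ℕ → Submodule K R) where
  rank : ℕ
  syz : Submodule R (Fin rank → R)
  lin : syz ⊓ maxHomogeneousIdeal 𝒜 ^ 2 • ⊤ ≤ maxHomogeneousIdeal 𝒜 • syz
  graded : ∀ v ∈ syz, ∃ w ∈ syz, (∀ j, w j ∈ 𝒜 1) ∧ ∀ j, (v - w) j ∈ maxHomogeneousIdeal 𝒜 ^ 2
  res : ∀ k, HasLinearResolution (maxHomogeneousIdeal 𝒜) k syz

variable {𝒜 : ℕ → Submodule K R}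

theorem IsLinearGrading.one_le (_h : IsLinearGrading 𝒜) {a : R} (ha : a ∈ 𝒜 1) :
    a ∈ maxHomogeneousIdeal 𝒜 :=
  Ideal.subset_span ⟨1, one_pos, ha⟩

theorem IsLinearGrading.eq_zero_of_algebraMap_mem (h : IsLinearGrading 𝒜) {c : K}
    (hc : algebraMap K R c ∈ maxHomogeneousIdeal 𝒜) : c = 0 := by
  by_contra h0
  exact h.ne_top (Ideal.eq_top_of_isUnit_mem _ hc ((IsUnit.mk0 c h0).map _))

/-- The columns of the next matrix are a K-basis of the syzygies with entries in degree 1. They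
generate by Nakayama, as every syzygy is such a one modulo m²-entries and `lin` absorbs the rest. -/
theorem LinearStage.exists_next [FiniteDimensional K R] (h : IsLinearGrading 𝒜)
    (s : LinearStage 𝒜) : ∃ (t : LinearStage 𝒜) (M : Matrix (Fin s.rank) (Fin t.rank) R),
      (∀ j k, M j k ∈ 𝒜 1) ∧ LinearMap.range M.mulVecLin = s.syz ∧
      t.syz = LinearMap.ker M.mulVecLin := by
  set m := maxHomogeneousIdeal 𝒜
  let U : Submodule K (Fin s.rank → R) :=
    s.syz.restrictScalars K ⊓ Submodule.pi Set.univ fun _ => 𝒜 1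
  have hU : ∀ v, v ∈ U ↔ v ∈ s.syz ∧ ∀ j, v j ∈ 𝒜 1 := fun v => by
    simp [U, Submodule.mem_pi]
  let u := Module.finBasis K U
  let M : Matrix (Fin s.rank) (Fin (Module.finrank K U)) R := Matrix.of fun j k => (u k).1 j
  have hu1 : ∀ k j, (u k).1 j ∈ 𝒜 1 := fun k j => ((hU _).1 (u k).2).2 j
  have hMv : ∀ v, M.mulVecLin v = ∑ k, v k • (u k).1 := by
    intro v
    ext j
    simp [M, Matrix.mulVec, dotProduct, mul_comm]
  have hMK : ∀ c : Fin (Module.finrank K U) → K,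
      M.mulVecLin (fun k => algebraMap K R (c k)) = (∑ k, c k • u k : U).1 := by
    intro c
    rw [hMv, AddSubmonoidClass.coe_finsetSum]
    exact Finset.sum_congr rfl fun k _ => by rw [algebraMap_smul]; rfl
  have hMs : ∀ v, M.mulVecLin v ∈ s.syz := fun v => by
    rw [hMv]
    exact Submodule.sum_mem _ fun k _ => Submodule.smul_mem _ _ ((hU _).1 (u k).2).1
  let p : (Fin (Module.finrank K U) → R) →ₗ[R] s.syz := M.mulVecLin.codRestrict _ hMs
  have hker : LinearMap.ker p = LinearMap.ker M.mulVecLin := LinearMap.ker_codRestrict _ _ _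
  have hp : Function.Surjective p := by
    rw [← LinearMap.range_eq_top]
    apply Submodule.eq_top_of_sup_smul_top_eq_top h.nilpotent
    rw [eq_top_iff]
    rintro ⟨x, hx⟩ -
    obtain ⟨w, hw, hw1, hw2⟩ := s.graded x hx
    have e : (⟨x, hx⟩ : s.syz) = ⟨w, hw⟩ + ⟨x - w, sub_mem hx hw⟩ := by
      ext1; simp
    rw [e]
    refine add_mem (Submodule.mem_sup_left ?_) (Submodule.mem_sup_right ?_)
    · refine ⟨fun k => algebraMap K R (u.repr ⟨w, (hU w).2 ⟨hw, hw1⟩⟩ k), Subtype.ext ?_⟩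
      change M.mulVecLin _ = w
      rw [hMK, u.sum_repr]
    · rw [Submodule.mem_smul_top_iff]
      exact s.lin ⟨sub_mem hx hw, (Submodule.mem_smul_top_pi_iff _ _).2 hw2⟩
  -- Relations among the columns start in degree 1, and their degree-1 part is itself a relation.
  -- This gives minimality and the `graded` field of the next stage.
  have hsplit : ∀ v, M.mulVecLin v = 0 → ∃ a, M.mulVecLin a = 0 ∧ (∀ k, a k ∈ 𝒜 1) ∧
      ∀ k, (v - a) k ∈ m ^ 2 := by
    intro v hv
    choose c a ha q hq hv' using fun k => h.exists_decomp (v k)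
    have hve : v = (fun k => algebraMap K R (c k)) + (a + q) := by
      ext k; rw [hv' k, add_assoc]; rfl
    have hapq : ∀ k, a k + q k ∈ m := fun k =>
      add_mem (h.one_le (ha k)) (Ideal.pow_le_self two_ne_zero (hq k))
    have hsum : ∀ {I : Ideal R} (x : Fin (Module.finrank K U) → R), (∀ k, x k ∈ I) →
        ∀ j, M.mulVecLin x j ∈ m * I := by
      intro I x hx j
      rw [hMv, Finset.sum_apply]
      refine Ideal.sum_mem _ fun k _ => ?_
      rw [Pi.smul_apply, smul_eq_mul, mul_comm (x k)]
      exact Ideal.mul_mem_mul (h.one_le (hu1 k j)) (hx k)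
    -- The constant parts combine the columns into a vector with linear entries lying in m², hence
    -- zero; the columns are K-independent.
    have hc : ∀ k, c k = 0 := by
      have h0 : (∑ k, c k • u k : U) = 0 := by
        ext j
        refine h.one_inf _ (((hU _).1 (∑ k, c k • u k : U).2).2 j) ?_
        rw [← hMK]
        have h1 : M.mulVecLin (fun k => algebraMap K R (c k)) = - M.mulVecLin (a + q) := by
          rw [eq_neg_iff_add_eq_zero, ← map_add, ← hve, hv]
        rw [h1, pow_two]
        exact neg_mem (hsum _ hapq j)
      exact Fintype.linearIndependent_iff.1 u.linearIndependent c h0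
    have hve' : v = a + q := by
      rw [hve]; ext k; simp [hc k]
    refine ⟨a, ?_, ha, fun k => by rw [hve', add_sub_cancel_left]; exact hq k⟩
    ext j
    -- M a has entries of degree 2, but equals -M q with entries in m³.
    refine h.two_inf _ ?_ ?_
    · rw [hMv, Finset.sum_apply]
      exact Submodule.sum_mem _ fun k _ => h.mul_mem _ (ha k) _ (hu1 k j)
    · have h1 : M.mulVecLin a = - M.mulVecLin q := by
        rw [eq_neg_iff_add_eq_zero, ← map_add, ← hve', hv]
      rw [h1, pow_succ']
      exact neg_mem (hsum _ hq j)
  have hmin : LinearMap.ker p ≤ m • ⊤ := by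
    rw [hker]
    intro v hv
    obtain ⟨a, -, ha, hva⟩ := hsplit v hv
    rw [Submodule.mem_smul_top_pi_iff]
    intro k
    have : v k = a k + (v - a) k := by simp
    rw [this]
    exact add_mem (h.one_le (ha k)) (Ideal.pow_le_self two_ne_zero (hva k))
  refine ⟨⟨Module.finrank K U, LinearMap.ker p, ((s.res 1).of_cover h.nilpotent hp hmin).1,
    fun v hv => ?_, fun k => ((s.res (k + 1)).of_cover h.nilpotent hp hmin).2⟩, M,
    fun j k => hu1 k j, ?_, hker⟩
  · rw [hker] at hv
    obtain ⟨a, ha0, ha, hva⟩ := hsplit v hv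
    exact ⟨a, by rw [hker]; exact ha0, ha, hva⟩
  · refine le_antisymm ?_ fun x hx => ?_
    · rintro _ ⟨v, rfl⟩; exact hMs v
    · obtain ⟨v, hv⟩ := hp ⟨x, hx⟩
      exact ⟨v, congrArg Subtype.val hv⟩

theorem isKoszulAlgebra_of_hasLinearResolution [FiniteDimensional K R] (h : IsLinearGrading 𝒜)
    (hres : ∀ k, HasLinearResolution (maxHomogeneousIdeal 𝒜) k (R ⧸ maxHomogeneousIdeal 𝒜)) :
    IsKoszulAlgebra 𝒜 := by
  set m := maxHomogeneousIdeal 𝒜 with hm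
  let p : (Fin 1 → R) →ₗ[R] R ⧸ m := m.mkQ ∘ₗ LinearMap.proj 0
  have hp : Function.Surjective p := by
    intro y
    obtain ⟨x, rfl⟩ := m.mkQ_surjective y
    exact ⟨fun _ => x, rfl⟩
  have hker : ∀ v, v ∈ LinearMap.ker p ↔ ∀ j, v j ∈ m := by
    intro v
    rw [LinearMap.mem_ker, Fin.forall_fin_one]
    exact Submodule.Quotient.mk_eq_zero m
  have hmin : LinearMap.ker p ≤ m • ⊤ := fun v hv =>
    (Submodule.mem_smul_top_pi_iff _ _).2 ((hker v).1 hv)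
  let s₀ : LinearStage 𝒜 :=
    { rank := 1
      syz := LinearMap.ker p
      lin := ((hres 1).of_cover h.nilpotent hp hmin).1
      graded := by
        intro v hv
        obtain ⟨c, a, ha, q, hq, hvq⟩ := h.exists_decomp (v 0)
        have hv0 := (hker v).1 hv 0
        have hc : c = 0 := h.eq_zero_of_algebraMap_mem (by
          have : algebraMap K R c = v 0 - (a + q) := by rw [hvq]; ring
          rw [this]
          exact sub_mem hv0 (add_mem (h.one_le ha) (Ideal.pow_le_self two_ne_zero hq)))
        refine ⟨fun _ => a, (hker _).2 fun _ => h.one_le ha, fun _ => ha, ?_⟩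
        rw [Fin.forall_fin_one]
        change v 0 - a ∈ m ^ 2
        rw [hvq, hc, map_zero, zero_add, add_sub_cancel_left]
        exact hq
      res := fun k => ((hres (k + 1)).of_cover h.nilpotent hp hmin).2 }
  choose next M hM1 hM2 hM3 using fun s : LinearStage 𝒜 => s.exists_next h
  -- Starts from the maximal ideal inside R^1 and iterates; consecutive matrices match because each
  -- stage is the kernel of the previous matrix.
  let s : ℕ → LinearStage 𝒜 := fun i => Nat.rec s₀ (fun _ t => next t) i
  refine ⟨fun i => (s i).rank, fun i => M (s i), rfl, fun i => hM1 (s i), fun v => ?_, fun i => ?_⟩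
  · rw [hM2 (s 0)]
    exact hker v
  · rw [hM2 (s (i + 1))]
    exact hM3 (s i)

end KoszulOfLinear

/-! ### The powers of the maximal ideal of `R_f` -/

section ApolarLinearGrading

variable {K : Type*} [Field K] [CharZero K] {n : ℕ} {f : MvPolynomial (Fin n) K}

theorem apolarAlgebra_finiteDimensional (hf : f.IsHomogeneous 3) :
    FiniteDimensional K (ApolarAlgebra f) := by
  have hfg : ∀ d, (apolarGrading f d).FG := fun d => (homogeneousSubmodule_fg _ _ d).map _
  refine ⟨?_⟩
  have : (⊤ : Submodule K (ApolarAlgebra f)) =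
      apolarGrading f 0 ⊔ apolarGrading f 1 ⊔ apolarGrading f 2 ⊔ apolarGrading f 3 := by
    refine (eq_top_iff.2 fun a _ => ?_).symm
    obtain ⟨c, a₁, h1, a₂, h2, a₃, h3, rfl⟩ := exists_cubic_decomposition hf a
    exact Submodule.add_mem_sup (Submodule.add_mem_sup (Submodule.add_mem_sup
      (algebraMap_mem_apolarGrading f c) h1) h2) h3
  rw [this]
  exact (((hfg 0).sup (hfg 1)).sup (hfg 2)).sup (hfg 3)

theorem exists_of_mem_maxHomogeneousIdeal_pow (hf : f.IsHomogeneous 3) {a : ApolarAlgebra f} :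
    (a ∈ maxHomogeneousIdeal (apolarGrading f) → ∃ a₁ ∈ apolarGrading f 1,
      ∃ a₂ ∈ apolarGrading f 2, ∃ a₃ ∈ apolarGrading f 3, a = a₁ + a₂ + a₃) ∧
    (a ∈ maxHomogeneousIdeal (apolarGrading f) ^ 2 →
      ∃ a₂ ∈ apolarGrading f 2, ∃ a₃ ∈ apolarGrading f 3, a = a₂ + a₃) ∧
    (a ∈ maxHomogeneousIdeal (apolarGrading f) ^ 3 → a ∈ apolarGrading f 3) ∧
    (a ∈ maxHomogeneousIdeal (apolarGrading f) ^ 4 → a = 0) := by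
  have z : ∀ {d e : ℕ} {a b : ApolarAlgebra f}, 3 < d + e → a ∈ apolarGrading f d →
    b ∈ apolarGrading f e → a * b = 0 := fun hde ha hb =>
      apolarGrading_eq_zero hf hde (mul_mem_apolarGrading ha hb)
  have h1 : ∀ {a}, a ∈ maxHomogeneousIdeal (apolarGrading f) → ∃ a₁ ∈ apolarGrading f 1,
      ∃ a₂ ∈ apolarGrading f 2, ∃ a₃ ∈ apolarGrading f 3, a = a₁ + a₂ + a₃ := by
    intro a ha
    rw [maxHomogeneousIdeal_eq_span] at ha
    exact exists_of_mem_span_linear hf le_rfl ha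
  have h2 : ∀ {a}, a ∈ maxHomogeneousIdeal (apolarGrading f) ^ 2 →
      ∃ a₂ ∈ apolarGrading f 2, ∃ a₃ ∈ apolarGrading f 3, a = a₂ + a₃ := by
    intro a ha
    rw [pow_two] at ha
    induction ha using Submodule.mul_induction_on' with
    | mem_mul_mem x hx y hy =>
      obtain ⟨x₁, hx1, x₂, hx2, x₃, hx3, rfl⟩ := h1 hx
      obtain ⟨y₁, hy1, y₂, hy2, y₃, hy3, rfl⟩ := h1 hy
      refine ⟨_, mul_mem_apolarGrading hx1 hy1, x₁ * y₂ + x₂ * y₁,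
        add_mem (mul_mem_apolarGrading hx1 hy2) (mul_mem_apolarGrading hx2 hy1), ?_⟩
      linear_combination z (by norm_num) hx1 hy3 + z (by norm_num) hx2 hy2 +
        z (by norm_num) hx2 hy3 + z (by norm_num) hx3 hy1 + z (by norm_num) hx3 hy2 +
        z (by norm_num) hx3 hy3
    | add x _ y _ hx hy =>
      obtain ⟨x₂, hx2, x₃, hx3, rfl⟩ := hx
      obtain ⟨y₂, hy2, y₃, hy3, rfl⟩ := hy
      exact ⟨_, add_mem hx2 hy2, _, add_mem hx3 hy3, by ring⟩
  have h3 : ∀ {a}, a ∈ maxHomogeneousIdeal (apolarGrading f) ^ 3 → a ∈ apolarGrading f 3 := by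
    intro a ha
    rw [pow_succ] at ha
    refine Submodule.mul_induction_on ha (fun x hx y hy => ?_) fun x y hx hy => add_mem hx hy
    obtain ⟨x₂, hx2, x₃, hx3, rfl⟩ := h2 hx
    obtain ⟨y₁, hy1, y₂, hy2, y₃, hy3, rfl⟩ := h1 hy
    have : (x₂ + x₃) * (y₁ + y₂ + y₃) = x₂ * y₁ := by
      linear_combination z (by norm_num) hx2 hy2 +
        z (by norm_num) hx2 hy3 + z (by norm_num) hx3 hy1 + z (by norm_num) hx3 hy2 +
        z (by norm_num) hx3 hy3
    rw [this]
    exact mul_mem_apolarGrading hx2 hy1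
  refine ⟨h1, h2, h3, fun ha => ?_⟩
  rw [pow_succ] at ha
  rw [← Ideal.mem_bot]
  refine Submodule.mul_induction_on ha (fun x hx y hy => ?_) fun x y hx hy => add_mem hx hy
  have hx3 := h3 hx
  obtain ⟨y₁, hy1, y₂, hy2, y₃, hy3, rfl⟩ := h1 hy
  rw [Ideal.mem_bot]
  linear_combination z (by norm_num) hx3 hy1 + z (by norm_num) hx3 hy2 + z (by norm_num) hx3 hy3

omit [CharZero K] in
theorem apolarGrading_le_maxHomogeneousIdeal_pow (f : MvPolynomial (Fin n) K) (d : ℕ)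
    {a : ApolarAlgebra f} (ha : a ∈ apolarGrading f d) :
    a ∈ maxHomogeneousIdeal (apolarGrading f) ^ d := by
  rw [← apolarGrading_pow] at ha
  have hle : apolarGrading f 1 ≤ (maxHomogeneousIdeal (apolarGrading f)).restrictScalars K :=
    fun x hx => mem_maxHomogeneousIdeal one_pos hx
  induction d generalizing a with
  | zero => rw [pow_zero, Ideal.one_eq_top]; trivial
  | succ d ih =>
    have hp : apolarGrading f 1 ^ (d + 1) = apolarGrading f 1 ^ d * apolarGrading f 1 := rfl
    rw [hp] at ha
    rw [pow_succ]
    exact Submodule.mul_induction_on ha (fun x hx y hy => Ideal.mul_mem_mul (ih hx) (hle hy))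
      fun x y hx hy => add_mem hx hy

theorem maxHomogeneousIdeal_ne_top (hf : f.IsHomogeneous 3) (hf0 : f ≠ 0) :
    maxHomogeneousIdeal (apolarGrading f) ≠ ⊤ := by
  have := apolarAlgebra_nontrivial hf0
  intro h
  obtain ⟨a₁, h1, a₂, h2, a₃, h3, he⟩ := (exists_of_mem_maxHomogeneousIdeal_pow hf).1
    (h ▸ Submodule.mem_top : (1 : ApolarAlgebra f) ∈ maxHomogeneousIdeal (apolarGrading f))
  have h0 : (1 : ApolarAlgebra f) ∈ apolarGrading f 0 := by
    simpa using algebraMap_mem_apolarGrading f 1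
  exact one_ne_zero (cubic_decomposition_unique hf h0 (neg_mem h1) (neg_mem h2) (neg_mem h3)
    (by rw [he]; ring)).1

theorem isLinearGrading_apolarGrading (hf : f.IsHomogeneous 3) (hf0 : f ≠ 0) :
    IsLinearGrading (apolarGrading f) := by
  refine ⟨⟨4, ?_⟩, maxHomogeneousIdeal_ne_top hf hf0, fun r => ?_,
    fun a ha b hb => mul_mem_apolarGrading ha hb, fun a ha ha2 => ?_, fun a ha ha3 => ?_⟩
  · rw [Submodule.zero_eq_bot, eq_bot_iff]
    intro a ha
    exact (exists_of_mem_maxHomogeneousIdeal_pow hf).2.2.2 ha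
  · obtain ⟨c, a₁, h1, a₂, h2, a₃, h3, rfl⟩ := exists_cubic_decomposition hf r
    refine ⟨c, a₁, h1, a₂ + a₃, add_mem (apolarGrading_le_maxHomogeneousIdeal_pow f 2 h2)
      (Ideal.pow_le_pow_right (by norm_num) (apolarGrading_le_maxHomogeneousIdeal_pow f 3 h3)), ?_⟩
    ring
  · obtain ⟨a₂, h2, a₃, h3, rfl⟩ := (exists_of_mem_maxHomogeneousIdeal_pow hf).2.1 ha2
    exact (cubic_decomposition_unique hf (zero_mem _) ha (neg_mem h2) (neg_mem h3) (by ring)).2.1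
  · have h3 := (exists_of_mem_maxHomogeneousIdeal_pow hf).2.2.1 ha3
    exact (cubic_decomposition_unique hf (zero_mem _) (zero_mem _) ha (neg_mem h3) (by ring)).2.2.1

end ApolarLinearGrading

/-! ### Extension of the base field -/

section BaseChange

theorem diffOp_map {K L : Type*} [Field K] [Field L] (φ : K →+* L) {n : ℕ}
    (g h : MvPolynomial (Fin n) K) : diffOp (map φ g) (map φ h) = map φ (diffOp g h) := by
  induction g using MvPolynomial.induction_on generalizing h with
  | C a =>
    rw [map_C, ← algebraMap_eq, ← algebraMap_eq, AlgHom.commutes, AlgHom.commutes,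
      Module.algebraMap_end_apply, Module.algebraMap_end_apply, smul_eq_C_mul, smul_eq_C_mul,
      map_mul, map_C]
  | add p q hp hq =>
    rw [map_add, map_add, map_add, LinearMap.add_apply, LinearMap.add_apply, hp, hq, map_add]
  | mul_X p i hp =>
    rw [map_mul, map_X, diffOp_mul_apply, diffOp_mul_apply, diffOp_X, diffOp_X, pderiv_map, hp]

variable {K L : Type u} [Field K] [Field L] [Algebra K L] {n : ℕ}

theorem apolarIdeal_le_comap (f : MvPolynomial (Fin n) K) :
    apolarIdeal f ≤ (apolarIdeal (map (algebraMap K L) f)).comap (map (algebraMap K L)) := by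
  intro g hg
  have hg' : diffOp g f = 0 := hg
  change diffOp _ _ = 0
  rw [diffOp_map, hg', map_zero]

noncomputable instance apolarBaseChangeAlgebra (f : MvPolynomial (Fin n) K) :
    Algebra (ApolarAlgebra f) (ApolarAlgebra (map (algebraMap K L) f)) :=
  (Ideal.quotientMap _ (map (algebraMap K L)) (apolarIdeal_le_comap f)).toAlgebra

variable {f : MvPolynomial (Fin n) K}

theorem apolarBaseChange_mk (g : MvPolynomial (Fin n) K) :
    algebraMap (ApolarAlgebra f) (ApolarAlgebra (map (algebraMap K L) f))
      (Ideal.Quotient.mk _ g) = Ideal.Quotient.mk _ (map (algebraMap K L) g) := rfl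

theorem apolarBaseChange_smul (r : ApolarAlgebra f) (b : ApolarAlgebra (map (algebraMap K L) f)) :
    r • b = algebraMap (ApolarAlgebra f) (ApolarAlgebra (map (algebraMap K L) f)) r * b := rfl

/-- A K-basis of L is a basis over `R_f`: for G_j over K, the operator Σ β_j G_j applied to f has
coefficients Σ β_j (coefficient of G_j(∂)f), which vanish only if every G_j(∂)f does. -/
instance apolarBaseChange_free (f : MvPolynomial (Fin n) K) :
    Module.Free (ApolarAlgebra f) (ApolarAlgebra (map (algebraMap K L) f)) := by
  let β := Module.Basis.ofVectorSpace K L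
  let v := fun i => Ideal.Quotient.mk (apolarIdeal (map (algebraMap K L) f)) (C (β i))
  have hli : LinearIndependent (ApolarAlgebra f) v := by
    rw [linearIndependent_iff']
    intro s g hg i hi
    choose G hG using fun i => Ideal.Quotient.mk_surjective (I := apolarIdeal f) (g i)
    rw [← hG i, apolar_mk_eq_zero_iff]
    have h1 : Ideal.Quotient.mk (apolarIdeal (map (algebraMap K L) f))
        (∑ i ∈ s, C (β i) * map (algebraMap K L) (G i)) = 0 := by
      rw [map_sum, ← hg]
      refine Finset.sum_congr rfl fun j _ => ?_
      rw [apolarBaseChange_smul, ← hG j, apolarBaseChange_mk, ← map_mul, mul_comm]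
    rw [apolar_mk_eq_zero_iff, map_sum, LinearMap.sum_apply] at h1
    ext m
    have h2 := congrArg (coeff m) h1
    rw [coeff_sum, coeff_zero] at h2
    have h3 : ∑ j ∈ s, coeff m (diffOp (G j) f) • β j = 0 := by
      rw [← h2]
      refine Finset.sum_congr rfl fun j _ => ?_
      rw [diffOp_mul_apply, diffOp_map, ← algebraMap_eq, AlgHom.commutes,
        Module.algebraMap_end_apply, coeff_smul, coeff_map, smul_eq_mul, Algebra.smul_def, mul_comm]
    exact linearIndependent_iff'.1 β.linearIndependent s _ h3 i hi
  have hsp : ⊤ ≤ Submodule.span (ApolarAlgebra f) (Set.range v) := by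
    intro b _
    obtain ⟨g, rfl⟩ := Ideal.Quotient.mk_surjective b
    induction g using MvPolynomial.induction_on' with
    | add p q hp hq => rw [map_add]; exact add_mem (hp trivial) (hq trivial)
    | monomial m c =>
      induction β.mem_span c using Submodule.span_induction with
      | zero => rw [map_zero, map_zero]; exact zero_mem _
      | add x y _ _ hx hy => rw [map_add, map_add]; exact add_mem (hx trivial) (hy trivial)
      | mem x hx =>
        obtain ⟨i, rfl⟩ := hx
        have : monomial m (β i) = map (algebraMap K L) (monomial m 1) * C (β i) := by
          rw [map_monomial, map_one, mul_comm, C_mul_monomial, mul_one]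
        rw [this, map_mul, ← apolarBaseChange_mk, ← apolarBaseChange_smul]
        exact Submodule.smul_mem _ _ (Submodule.subset_span ⟨i, rfl⟩)
      | smul a x _ hx =>
        have : monomial m (a • x) = map (algebraMap K L) (C a) * monomial m x := by
          rw [map_C, C_mul_monomial, Algebra.smul_def]
        rw [this, map_mul, ← apolarBaseChange_mk, ← apolarBaseChange_smul]
        exact Submodule.smul_mem _ _ (hx trivial)
  exact Module.Free.of_basis (Module.Basis.mk hli hsp)

theorem map_maxHomogeneousIdeal (f : MvPolynomial (Fin n) K) :
    (maxHomogeneousIdeal (apolarGrading f)).map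
      (algebraMap (ApolarAlgebra f) (ApolarAlgebra (map (algebraMap K L) f))) =
      maxHomogeneousIdeal (apolarGrading (map (algebraMap K L) f)) := by
  rw [maxHomogeneousIdeal_eq_span, maxHomogeneousIdeal_eq_span]
  refine le_antisymm (Ideal.map_le_iff_le_comap.2 (Ideal.span_le.2 fun a ha => ?_))
    (Ideal.span_le.2 fun b hb => ?_)
  · obtain ⟨g, hg, rfl⟩ := mem_apolarGrading.1 ha
    exact Ideal.subset_span (mk_mem_apolarGrading (hg.map _))
  · obtain ⟨v, rfl⟩ := exists_apolarLinear_eq hb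
    rw [apolarLinear, Fintype.linearCombination_apply]
    refine Submodule.sum_mem _ fun i _ => ?_
    rw [apolarAlgebra_smul_def]
    refine Ideal.mul_mem_left _ _ ?_
    have : Ideal.Quotient.mk (apolarIdeal (map (algebraMap K L) f)) (X i) =
        algebraMap (ApolarAlgebra f) _ (Ideal.Quotient.mk _ (X i)) := by
      rw [apolarBaseChange_mk, map_X]
    rw [this]
    exact Ideal.mem_map_of_mem _ (Ideal.subset_span (mk_mem_apolarGrading (isHomogeneous_X _ i)))

end BaseChange

/-! ### Descent of the Koszul property -/

section Descent

theorem IsLinearGrading.isMaximal {K R : Type*} [Field K] [CommRing R] [Algebra K R]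
    {𝒜 : ℕ → Submodule K R} (h : IsLinearGrading 𝒜) : (maxHomogeneousIdeal 𝒜).IsMaximal := by
  refine Ideal.isMaximal_iff.2 ⟨fun h1 => h.ne_top ((Ideal.eq_top_iff_one _).2 h1),
    fun J x hJ hx hxJ => ?_⟩
  obtain ⟨c, a, ha, q, hq, rfl⟩ := h.exists_decomp x
  have haq := add_mem (h.one_le ha) (Ideal.pow_le_self two_ne_zero hq)
  have hc : c ≠ 0 := by
    rintro rfl
    exact hx (by rwa [map_zero, zero_add])
  have hcJ : algebraMap K R c ∈ J := by
    have : algebraMap K R c = (algebraMap K R c + a + q) - (a + q) := by ring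
    rw [this]
    exact sub_mem hxJ (hJ haq)
  rw [Ideal.eq_top_of_isUnit_mem _ hcJ ((IsUnit.mk0 c hc).map _)]
  trivial

/-- Modulo mI an element of I is a linear form of I; if it also lies in m², that linear form is
zero. -/
theorem IsLinearGrading.inf_sq_le {K R : Type*} [Field K] [CommRing R] [Algebra K R]
    {𝒜 : ℕ → Submodule K R} (h : IsLinearGrading 𝒜) {s : Set R} (hs : s ⊆ (𝒜 1 : Set R)) :
    Ideal.span s ⊓ maxHomogeneousIdeal 𝒜 ^ 2 ≤ maxHomogeneousIdeal 𝒜 * Ideal.span s := by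
  have hle : Ideal.span s ≤ maxHomogeneousIdeal 𝒜 := Ideal.span_le.2 fun x hx => h.one_le (hs hx)
  rintro x ⟨hx, hx2⟩
  obtain ⟨u, hu, -, j, hj, rfl⟩ : ∃ u ∈ 𝒜 1, u ∈ Ideal.span s ∧
      ∃ j ∈ maxHomogeneousIdeal 𝒜 * Ideal.span s, x = u + j := by
    clear hx2
    induction hx using Submodule.span_induction with
    | mem u hu => exact ⟨u, hs hu, Ideal.subset_span hu, 0, zero_mem _, (add_zero u).symm⟩
    | zero => exact ⟨0, zero_mem _, zero_mem _, 0, zero_mem _, (add_zero 0).symm⟩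
    | add a b _ _ ha hb =>
      obtain ⟨u, hu, hus, j, hj, rfl⟩ := ha
      obtain ⟨u', hu', hus', j', hj', rfl⟩ := hb
      exact ⟨_, add_mem hu hu', add_mem hus hus', _, add_mem hj hj', by ring⟩
    | smul r a _ ha =>
      obtain ⟨u, hu, hus, j, hj, rfl⟩ := ha
      obtain ⟨c, a, ha, q, hq, rfl⟩ := h.exists_decomp r
      refine ⟨c • u, Submodule.smul_mem _ _ hu, ?_, (a + q) * u + (algebraMap K R c + a + q) * j,
        add_mem (Ideal.mul_mem_mul (add_mem (h.one_le ha) (Ideal.pow_le_self two_ne_zero hq)) hus)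
          (Ideal.mul_mem_left _ _ hj), ?_⟩
      · rw [Algebra.smul_def]; exact Ideal.mul_mem_left _ _ hus
      · rw [smul_eq_mul, Algebra.smul_def]; ring
  have hu0 : u = 0 := h.one_inf u hu (by
    have : u = (u + j) - j := by ring
    rw [this, pow_two]
    rw [pow_two] at hx2
    exact sub_mem hx2 (Ideal.mul_mono_right hle hj))
  rw [hu0, zero_add]
  exact hj

/-- R/m → B/mB splits R-linearly, by a functional on B rescaled to send 1 to 1 modulo m. -/
theorem hasLinearResolution_residue_of_free {R B : Type u} [CommRing R] [CommRing B] [Algebra R B]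
    [Module.Free R B] {m : Ideal R} (hm : IsNilpotent m) [hmax : m.IsMaximal]
    (hB : m.map (algebraMap R B) ≠ ⊤) {k : ℕ}
    (h : HasLinearResolution m k (B ⧸ m.map (algebraMap R B))) :
    HasLinearResolution m k (R ⧸ m) := by
  have htop : (m • ⊤ : Submodule R B) = (m.map (algebraMap R B)).restrictScalars R :=
    Ideal.smul_top_eq_map m
  have h' := h.of_equiv (Submodule.Quotient.restrictScalarsEquiv R (m.map (algebraMap R B))).symm
  -- If every functional sent 1 into m, all coordinates of 1 in an R-basis would lie in m, forcing
  -- mB = B.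
  obtain ⟨ρ, hρ⟩ : ∃ ρ : B →ₗ[R] R, ρ 1 ∉ m := by
    by_contra! hcon
    let b := Module.Free.chooseBasis R B
    apply hB
    rw [Ideal.eq_top_iff_one]
    have h1 : (1 : B) ∈ (m • ⊤ : Submodule R B) := by
      rw [← b.linearCombination_repr 1, Finsupp.linearCombination_apply]
      exact Submodule.sum_mem _ fun i _ => Submodule.smul_mem_smul (hcon (b.coord i)) trivial
    rw [htop] at h1
    exact h1
  obtain ⟨t, ht⟩ : ∃ t : R, t * ρ 1 - 1 ∈ m := by
    let _ := Ideal.Quotient.field m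
    obtain ⟨t, ht⟩ := Ideal.Quotient.mk_surjective (Ideal.Quotient.mk m (ρ 1))⁻¹
    refine ⟨t, ?_⟩
    rw [← Ideal.Quotient.eq_zero_iff_mem, map_sub, map_mul, ht,
      map_one (Ideal.Quotient.mk m), sub_eq_zero]
    exact inv_mul_cancel₀ fun h0 => hρ (Ideal.Quotient.eq_zero_iff_mem.1 h0)
  refine HasLinearResolution.of_retract hm
    (i := Submodule.mapQ m ((m.map (algebraMap R B)).restrictScalars R) (Algebra.linearMap R B)
      fun r hr => Ideal.mem_map_of_mem _ hr)
    (p := Submodule.mapQ ((m.map (algebraMap R B)).restrictScalars R) m (t • ρ) fun b hb => ?_)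
    (fun x => ?_) h'
  · rw [← htop] at hb
    have := Submodule.smul_top_map_le m (t • ρ) hb
    rwa [smul_eq_mul, Ideal.mul_top] at this
  · obtain ⟨r, rfl⟩ := Submodule.mkQ_surjective m x
    change Submodule.Quotient.mk ((t • ρ) (algebraMap R B r)) = Submodule.Quotient.mk r
    rw [Submodule.Quotient.eq, Algebra.algebraMap_eq_smul_one, map_smul, LinearMap.smul_apply,
      smul_eq_mul, smul_eq_mul]
    have : r * (t * ρ 1) - r = r * (t * ρ 1 - 1) := by ring
    rw [this]
    exact Ideal.mul_mem_left _ _ ht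

/-- A Koszul filtration over an extension field implies the Koszul property. -/
theorem isKoszulAlgebra_of_isKoszulFiltration_map {K L : Type u} [Field K] [CharZero K] [Field L]
    [Algebra K L] {n : ℕ} {f : MvPolynomial (Fin n) K} (hf : f.IsHomogeneous 3) (hf0 : f ≠ 0)
    {F : Set (Ideal (ApolarAlgebra (map (algebraMap K L) f)))}
    (hF : IsKoszulFiltration (apolarGrading (map (algebraMap K L) f)) F) :
    IsKoszulAlgebra (apolarGrading f) := by
  have : CharZero L := charZero_of_injective_algebraMap (algebraMap K L).injective
  have hfL : (map (algebraMap K L) f).IsHomogeneous 3 := hf.map _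
  have hfL0 : map (algebraMap K L) f ≠ 0 := fun h => hf0 (map_injective _ (algebraMap K L).injective
    (by rw [h, map_zero]))
  have hR := isLinearGrading_apolarGrading hf hf0
  have hB := isLinearGrading_apolarGrading hfL hfL0
  have := apolarAlgebra_finiteDimensional hf
  have := apolarAlgebra_finiteDimensional hfL
  have : IsArtinianRing (ApolarAlgebra (map (algebraMap K L) f)) := IsArtinianRing.of_finite L _
  have := hR.isMaximal
  have hmap := map_maxHomogeneousIdeal (L := L) f
  have hle : ∀ I ∈ F, I ≤ maxHomogeneousIdeal (apolarGrading (map (algebraMap K L) f)) := by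
    intro I hI
    obtain ⟨s, hs, rfl⟩ := hF.generated_by_linear I hI
    exact Ideal.span_le.2 fun x hx => hB.one_le (hs hx)
  refine isKoszulAlgebra_of_hasLinearResolution hR fun k => ?_
  refine hasLinearResolution_residue_of_free (B := ApolarAlgebra (map (algebraMap K L) f))
    hR.nilpotent (by rw [hmap]; exact hB.ne_top) ?_
  refine hasLinearResolution_of_filtration (F := F) (by rw [hmap]; exact hle) ?_ hF.exists_colon k _
    (by rw [hmap]; exact hF.max_mem)
  rw [hmap]
  intro I hI
  obtain ⟨s, hs, rfl⟩ := hF.generated_by_linear I hI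
  exact hB.inf_sq_le hs

end Descent

/-! ### Smoothness of the generic cubic by a Macaulay determinant -/

section GenericSmooth

variable {K : Type*} [Field K] {n : ℕ}

/-- The coefficient of `m` in the generic form of degree `d`. -/
noncomputable def genericCoeff (K : Type*) [Field K] (n d : ℕ) (m : Fin n →₀ ℕ) :
    MvPolynomial {m : Fin n →₀ ℕ // m.degree = d} K :=
  if h : m.degree = d then X ⟨m, h⟩ else 0

theorem eval_genericCoeff {d : ℕ} {f : MvPolynomial (Fin n) K} (hf : f.IsHomogeneous d)
    (m : Fin n →₀ ℕ) : eval (fun m => coeff m.1 f) (genericCoeff K n d m) = coeff m f := by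
  unfold genericCoeff
  split_ifs with h
  · rw [eval_X]
  · rw [map_zero, hf.coeff_eq_zero h]

/-- Pigeonhole. The degree n + 1 = n(2 - 1) + 1 is Macaulay's bound for the n quadrics ∂f/∂x_i. -/
theorem Finsupp.exists_two_le_of_degree {m : Fin n →₀ ℕ} (h : m.degree = n + 1) :
    ∃ i, 2 ≤ m i := by
  by_contra! hlt
  have h1 : m.degree ≤ ∑ _i : Fin n, 1 := by
    rw [Finsupp.degree_eq_sum]
    exact Finset.sum_le_sum fun i _ => by have := hlt i; omega
  rw [Finset.sum_const, Finset.card_univ, Fintype.card_fin, smul_eq_mul, mul_one] at h1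
  omega

/-- The monomials of degree `n + 1` in `n` variables. -/
abbrev TopMonomial (n : ℕ) : Type := (Finset.univ : Finset (Fin n)).finsuppAntidiag (n + 1)

theorem TopMonomial.degree_eq (μ : TopMonomial n) : μ.1.degree = n + 1 := by
  rw [Finsupp.degree_eq_sum]
  exact (Finset.mem_finsuppAntidiag.1 μ.2).1

theorem mem_finsuppAntidiag_of_degree {m : Fin n →₀ ℕ} {d : ℕ} (h : m.degree = d) :
    m ∈ (Finset.univ : Finset (Fin n)).finsuppAntidiag d := by
  rw [Finsupp.degree_eq_sum] at h
  exact Finset.mem_finsuppAntidiag.2 ⟨h, Finset.subset_univ _⟩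

/-- A variable whose square divides the monomial `μ`. -/
noncomputable def TopMonomial.index (μ : TopMonomial n) : Fin n :=
  (Finsupp.exists_two_le_of_degree μ.degree_eq).choose

theorem TopMonomial.two_le (μ : TopMonomial n) : 2 ≤ μ.1 μ.index :=
  (Finsupp.exists_two_le_of_degree μ.degree_eq).choose_spec

/-- The quotient of the monomial `μ` by the square of a variable. -/
noncomputable def TopMonomial.cofactor (μ : TopMonomial n) : Fin n →₀ ℕ :=
  μ.1 - Finsupp.single μ.index 2

theorem TopMonomial.cofactor_add (μ : TopMonomial n) :
    μ.cofactor + Finsupp.single μ.index 2 = μ.1 :=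
  tsub_add_cancel_of_le (Finsupp.single_le_iff.2 μ.two_le)

theorem TopMonomial.degree_cofactor (μ : TopMonomial n) : μ.cofactor.degree + 2 = n + 1 := by
  rw [← μ.degree_eq, ← μ.cofactor_add, map_add, Finsupp.degree_single]

/-- A maximal minor of the Macaulay matrix of the partial derivatives of `f`. -/
noncomputable def jacobianMatrix (f : MvPolynomial (Fin n) K) :
    Matrix (TopMonomial n) (TopMonomial n) K :=
  Matrix.of fun μ ν => coeff ν.1 (monomial μ.cofactor 1 * pderiv μ.index f)

open scoped Classical in
/-- The Macaulay minor of the generic cubic. -/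
noncomputable def genericJacobianMatrix (K : Type*) [Field K] (n : ℕ) :
    Matrix (TopMonomial n) (TopMonomial n) (MvPolynomial {m : Fin n →₀ ℕ // m.degree = 3} K) :=
  Matrix.of fun μ ν => if μ.cofactor ≤ ν.1 then
    genericCoeff K n 3 (ν.1 - μ.cofactor + Finsupp.single μ.index 1) *
      (((ν.1 - μ.cofactor) μ.index + 1 : ℕ) : MvPolynomial {m : Fin n →₀ ℕ // m.degree = 3} K)
    else 0

theorem eval_genericJacobianMatrix_det {f : MvPolynomial (Fin n) K} (hf : f.IsHomogeneous 3) :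
    eval (fun m => coeff m.1 f) (genericJacobianMatrix K n).det = (jacobianMatrix f).det := by
  rw [RingHom.map_det]
  congr 1
  ext μ ν
  simp only [RingHom.mapMatrix_apply, Matrix.map_apply, genericJacobianMatrix, jacobianMatrix,
    Matrix.of_apply]
  rw [coeff_monomial_mul', one_mul, coeff_pderiv]
  split_ifs with h
  · rw [map_mul, eval_genericCoeff hf, map_natCast, Nat.cast_add, Nat.cast_one]
  · rw [map_zero]

/-- For the Fermat cubic the row of μ is the polynomial (μ/x_i²) · 3x_i² = 3μ. -/
theorem jacobianMatrix_fermat :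
    jacobianMatrix (∑ i : Fin n, X i ^ 3 : MvPolynomial (Fin n) K) = (3 : K) • 1 := by
  ext μ ν
  have h : pderiv μ.index (∑ i : Fin n, X i ^ 3 : MvPolynomial (Fin n) K) =
      monomial (Finsupp.single μ.index 2) 3 := by
    rw [map_sum, Finset.sum_eq_single μ.index]
    · rw [X_pow_eq_monomial, pderiv_monomial_single]; norm_num
    · intro j _ hj
      rw [pderiv_pow, pderiv_X_of_ne hj, mul_zero]
    · exact fun h => absurd (Finset.mem_univ _) h
  rw [jacobianMatrix, Matrix.of_apply, h, monomial_mul, μ.cofactor_add, one_mul, coeff_monomial,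
    Matrix.smul_apply, Matrix.one_apply, smul_eq_mul]
  by_cases hμ : μ = ν
  · rw [if_pos hμ, if_pos (congrArg Subtype.val hμ), mul_one]
  · rw [if_neg hμ, if_neg fun h => hμ (Subtype.ext h), mul_zero]

/-- At a singular point p the values of all monomials of degree n + 1 form a kernel vector of the
matrix. It must vanish, and its entries p_i^(n+1) give p = 0. -/
theorem isSmoothForm_of_jacobianMatrix_det_ne_zero {f : MvPolynomial (Fin n) K}
    (hf : f.IsHomogeneous 3) (h : (jacobianMatrix f).det ≠ 0) : IsSmoothForm f := by
  intro p hp0 _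
  by_contra! hp
  have hv : ((jacobianMatrix f).map (algebraMap K (AlgebraicClosure K))).mulVec
      (fun ν : TopMonomial n => ∏ i, p i ^ ν.1 i) = 0 := by
    ext μ
    set g := monomial μ.cofactor 1 * pderiv μ.index f with hg
    have hgh : g.IsHomogeneous (n + 1) := by
      rw [← μ.degree_cofactor]
      exact (isHomogeneous_monomial 1 rfl).mul hf.pderiv
    have h1 : aeval p g = 0 := by rw [hg, map_mul, hp, mul_zero]
    rw [aeval_def, eval₂_eq'] at h1
    rw [Matrix.mulVec, dotProduct, Pi.zero_apply, ← h1]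
    simp only [Matrix.map_apply, jacobianMatrix, Matrix.of_apply]
    rw [← hg, Finset.sum_coe_sort ((Finset.univ : Finset (Fin n)).finsuppAntidiag (n + 1))
      (fun ν => algebraMap K (AlgebraicClosure K) (coeff ν g) * ∏ i, p i ^ ν i)]
    symm
    refine Finset.sum_subset (fun ν hν => mem_finsuppAntidiag_of_degree
      (hgh.degree_eq_sum_deg_support hν).symm) fun ν _ hν => ?_
    rw [notMem_support_iff.1 hν, map_zero, zero_mul]
  have hdet : ((jacobianMatrix f).map (algebraMap K (AlgebraicClosure K))).det ≠ 0 := by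
    rw [← RingHom.mapMatrix_apply, ← RingHom.map_det]
    exact (map_ne_zero _).2 h
  have h0 := Matrix.eq_zero_of_mulVec_eq_zero hdet hv
  apply hp0
  ext i
  have := congrFun h0 ⟨Finsupp.single i (n + 1), mem_finsuppAntidiag_of_degree
    (Finsupp.degree_single _ _)⟩
  simp only [Pi.zero_apply] at this
  rw [Finset.prod_eq_single i (fun j _ hj => by
    rw [Finsupp.single_eq_of_ne hj, pow_zero]) (fun h => absurd (Finset.mem_univ _) h),
    Finsupp.single_eq_same] at this
  exact eq_zero_of_pow_eq_zero this

theorem genericJacobianMatrix_det_ne_zero [CharZero K] : (genericJacobianMatrix K n).det ≠ 0 := by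
  intro h
  have hf : (∑ i : Fin n, X i ^ 3 : MvPolynomial (Fin n) K).IsHomogeneous 3 :=
    IsHomogeneous.sum _ _ _ fun i _ => isHomogeneous_X_pow i 3
  have h1 := eval_genericJacobianMatrix_det hf
  rw [h, map_zero, jacobianMatrix_fermat, Matrix.det_smul, Matrix.det_one, mul_one] at h1
  exact pow_ne_zero _ three_ne_zero h1.symm

end GenericSmooth

/-! ### Trilinear forms and pencils of contractions -/

section TrilinearForms

variable {A A' : Type*} [CommRing A] [CommRing A'] {n : ℕ}

/-- The matrix of the bilinear form obtained from a trilinear form by fixing one argument. -/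
def contract (T : Fin n → Fin n → Fin n → A) (v : Fin n → A) : Matrix (Fin n) (Fin n) A :=
  Matrix.of fun i j => ∑ k, v k * T i j k

theorem contract_map (φ : A →+* A') (T : Fin n → Fin n → Fin n → A) (v : Fin n → A) :
    φ.mapMatrix (contract T v) = contract (fun i j k => φ (T i j k)) fun k => φ (v k) := by
  ext i j
  simp [contract]

theorem contract_add (T : Fin n → Fin n → Fin n → A) (v w : Fin n → A) :
    contract T (v + w) = contract T v + contract T w := by
  ext i j
  simp [contract, add_mul, Finset.sum_add_distrib]

theorem contract_smul (T : Fin n → Fin n → Fin n → A) (c : A) (v : Fin n → A) :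
    contract T (c • v) = c • contract T v := by
  ext i j
  simp [contract, Finset.mul_sum, mul_assoc]

theorem contract_zero (T : Fin n → Fin n → Fin n → A) : contract T 0 = 0 := by
  ext i j
  simp [contract]

theorem contract_single (T : Fin n → Fin n → Fin n → A) (k : Fin n) :
    contract T (Pi.single k 1) = Matrix.of fun i j => T i j k := by
  ext i j
  simp [contract, Pi.single_apply]

theorem contract_mulVec_comm {T : Fin n → Fin n → Fin n → A} (hT : ∀ i j k, T i j k = T i k j)
    (v w : Fin n → A) : (contract T v).mulVec w = (contract T w).mulVec v := by
  ext i
  simp only [contract, Matrix.mulVec, dotProduct, Matrix.of_apply, Finset.sum_mul]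
  rw [Finset.sum_comm]
  refine Finset.sum_congr rfl fun j _ => Finset.sum_congr rfl fun k _ => ?_
  rw [hT i k j]; ring

/-- The direction of the pencil of vectors through `e_{i₀}`. -/
def pencilDirection (A : Type*) [CommRing A] (i₀ i₁ : Fin n) : Fin n → A :=
  Pi.single i₀ 1 + Pi.single i₁ 1

/-- The point `c e_{i₀} + t (e_{i₀} + e_{i₁})` of the pencil. -/
def pencilPoint (i₀ i₁ : Fin n) (c t : A) : Fin n → A :=
  c • Pi.single i₀ 1 + t • pencilDirection A i₀ i₁

/-- A column of the adjugate, in the kernel if the determinant vanishes. -/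
def adjugateColumn (T : Fin n → Fin n → Fin n → A) (i₁ : Fin n) (y : Fin n → A) : Fin n → A :=
  fun i => (contract T y).adjugate i i₁

/-- The obstruction to the contraction with `adjugateColumn` having corank at most one. -/
def pencilObstruction (T : Fin n → Fin n → Fin n → A) (i₀ i₁ : Fin n) (c t : A) : A :=
  (contract T (adjugateColumn T i₁ (pencilPoint i₀ i₁ c t))).adjugate i₀ i₀

theorem pencilDirection_map (φ : A →+* A') (i₀ i₁ : Fin n) :
    (fun k => φ (pencilDirection A i₀ i₁ k)) = pencilDirection A' i₀ i₁ := by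
  ext k
  simp [pencilDirection, Pi.single_apply, apply_ite φ]

theorem pencilPoint_map (φ : A →+* A') (i₀ i₁ : Fin n) (c t : A) :
    (fun k => φ (pencilPoint i₀ i₁ c t k)) = pencilPoint i₀ i₁ (φ c) (φ t) := by
  ext k
  simp [pencilPoint, ← congrFun (pencilDirection_map φ i₀ i₁) k, Pi.single_apply, apply_ite φ]

theorem adjugateColumn_map (φ : A →+* A') (T : Fin n → Fin n → Fin n → A) (i₁ : Fin n)
    (y : Fin n → A) : (fun k => φ (adjugateColumn T i₁ y k)) =
      adjugateColumn (fun i j k => φ (T i j k)) i₁ fun k => φ (y k) := by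
  ext k
  rw [adjugateColumn, adjugateColumn, ← contract_map, ← RingHom.map_adjugate]
  rfl

theorem pencilObstruction_map (φ : A →+* A') (T : Fin n → Fin n → Fin n → A) (i₀ i₁ : Fin n)
    (c t : A) : φ (pencilObstruction T i₀ i₁ c t) =
      pencilObstruction (fun i j k => φ (T i j k)) i₀ i₁ (φ c) (φ t) := by
  rw [pencilObstruction, pencilObstruction, ← pencilPoint_map, ← adjugateColumn_map,
    ← contract_map, ← RingHom.map_adjugate]
  rfl

/-- The determinant of the contraction with the direction of the pencil. -/
def pencilDet (T : Fin n → Fin n → Fin n → A) (i₀ i₁ : Fin n) : A :=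
  (contract T (pencilDirection A i₀ i₁)).det

/-- A matrix whose eigenvalues are the parameters of the degenerate members of the pencil. -/
def pencilMatrix (T : Fin n → Fin n → Fin n → A) (i₀ i₁ : Fin n) : Matrix (Fin n) (Fin n) A :=
  -((contract T (pencilDirection A i₀ i₁)).adjugate * contract T (Pi.single i₀ 1))

theorem pencilDet_map (φ : A →+* A') (T : Fin n → Fin n → Fin n → A) (i₀ i₁ : Fin n) :
    φ (pencilDet T i₀ i₁) = pencilDet (fun i j k => φ (T i j k)) i₀ i₁ := by
  rw [pencilDet, pencilDet, RingHom.map_det, contract_map, pencilDirection_map]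

theorem pencilMatrix_map (φ : A →+* A') (T : Fin n → Fin n → Fin n → A) (i₀ i₁ : Fin n) :
    φ.mapMatrix (pencilMatrix T i₀ i₁) = pencilMatrix (fun i j k => φ (T i j k)) i₀ i₁ := by
  have h : (fun k => φ ((Pi.single i₀ 1 : Fin n → A) k)) = Pi.single i₀ 1 := by
    ext k; simp [Pi.single_apply, apply_ite φ]
  rw [pencilMatrix, pencilMatrix, map_neg, map_mul, RingHom.map_adjugate, contract_map,
    contract_map, pencilDirection_map, h]

/-- The obstruction as a polynomial in the parameter of the pencil. -/
noncomputable def obstructionPoly (T : Fin n → Fin n → Fin n → A) (i₀ i₁ : Fin n) : Polynomial A :=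
  pencilObstruction (fun i j k => Polynomial.C (T i j k)) i₀ i₁
    (Polynomial.C (pencilDet T i₀ i₁)) Polynomial.X

theorem obstructionPoly_map (φ : A →+* A') (T : Fin n → Fin n → Fin n → A) (i₀ i₁ : Fin n) :
    (obstructionPoly T i₀ i₁).map φ = obstructionPoly (fun i j k => φ (T i j k)) i₀ i₁ := by
  rw [obstructionPoly, obstructionPoly, ← Polynomial.coe_mapRingHom, pencilObstruction_map]
  simp only [Polynomial.coe_mapRingHom, Polynomial.map_C, Polynomial.map_X, pencilDet_map]

theorem obstructionPoly_eval (T : Fin n → Fin n → Fin n → A) (i₀ i₁ : Fin n) (t : A) :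
    (obstructionPoly T i₀ i₁).eval t = pencilObstruction T i₀ i₁ (pencilDet T i₀ i₁) t := by
  rw [obstructionPoly, ← Polynomial.coe_evalRingHom, pencilObstruction_map]
  simp only [Polynomial.coe_evalRingHom, Polynomial.eval_C, Polynomial.eval_X]

/-- The remainder of a power of the obstruction modulo the characteristic polynomial. -/
noncomputable def obstructionRemainder (T : Fin n → Fin n → Fin n → A) (i₀ i₁ : Fin n) :
    Polynomial A :=
  obstructionPoly T i₀ i₁ ^ n %ₘ (pencilMatrix T i₀ i₁).charpoly

/-- Division by a monic polynomial commutes with ring maps, so the coefficients of the remainder are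
universal polynomials in the entries of T. -/
theorem obstructionRemainder_map (φ : A →+* A') (T : Fin n → Fin n → Fin n → A) (i₀ i₁ : Fin n) :
    (obstructionRemainder T i₀ i₁).map φ = obstructionRemainder (fun i j k => φ (T i j k)) i₀ i₁ := by
  rw [obstructionRemainder, obstructionRemainder,
    Polynomial.map_modByMonic _ (Matrix.charpoly_monic _), Polynomial.map_pow, obstructionPoly_map,
    ← Matrix.charpoly_map, ← RingHom.mapMatrix_apply, pencilMatrix_map]

end TrilinearForms

/-! ### Corank-one pairs from nonvanishing adjugates -/

section CorankOneOfAdjugate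

variable {L : Type*} [Field L] {n : ℕ}

/-- The adjugate entry is the determinant of M with row j replaced by e_i. If it is nonzero, a
kernel vector is determined by its i-th coordinate, so the kernel is a line. -/
theorem Matrix.rank_add_one_of_adjugate_ne_zero {M : Matrix (Fin n) (Fin n) L} {i j : Fin n}
    (h : M.adjugate i j ≠ 0) {v : Fin n → L} (hv : M.mulVec v = 0) (hv0 : v ≠ 0) :
    M.rank + 1 = n := by
  have hinj : Function.Injective ((LinearMap.proj i : (Fin n → L) →ₗ[L] L) ∘ₗ
      (LinearMap.ker M.mulVecLin).subtype) := by
    rw [← LinearMap.ker_eq_bot, eq_bot_iff]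
    rintro ⟨w, hw⟩ hwi
    have hwi' : w i = 0 := hwi
    have hw' : M.mulVec w = 0 := hw
    rw [Matrix.adjugate_apply] at h
    have h0 : (M.updateRow j (Pi.single i 1)).mulVec w = 0 := by
      ext k
      by_cases hk : k = j
      · subst hk
        simp [Matrix.mulVec, hwi']
      · have := congrFun hw' k
        simpa [Matrix.mulVec, Matrix.updateRow_ne hk] using this
    exact Subtype.ext (Matrix.eq_zero_of_mulVec_eq_zero h h0)
  have h1 := LinearMap.finrank_le_finrank_of_injective hinj
  rw [Module.finrank_self] at h1
  have h2 : 0 < Module.finrank L (LinearMap.ker M.mulVecLin) :=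
    Module.finrank_pos_iff_exists_ne_zero.2 ⟨⟨v, hv⟩, fun h => hv0 (congrArg Subtype.val h)⟩
  have h3 := LinearMap.finrank_range_add_finrank_ker M.mulVecLin
  rw [Module.finrank_fin_fun] at h3
  change M.rank + _ = n at h3
  omega

/-- The adjugate column z is killed by the singular matrix of y, and by symmetry y is killed by that
of z. The nonzero obstruction bounds the corank of the matrix of z by one, and also forces z ≠ 0,
which bounds the corank for y. -/
theorem pencil_corank_one {T : Fin n → Fin n → Fin n → L} (hT : ∀ i j k, T i j k = T i k j)
    {i₀ i₁ : Fin n} (h01 : i₀ ≠ i₁) {c t : L}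
    (hdet : (contract T (pencilPoint i₀ i₁ c t)).det = 0)
    (hg : pencilObstruction T i₀ i₁ c t ≠ 0) :
    ∃ y z : Fin n → L, (contract T y).mulVec z = 0 ∧ (contract T y).rank + 1 = n ∧
      (contract T z).rank + 1 = n := by
  have : Nontrivial (Fin n) := ⟨i₀, i₁, h01⟩
  set y := pencilPoint i₀ i₁ c t
  set z := adjugateColumn T i₁ y with hz
  have hz0 : z ≠ 0 := by
    intro h0
    apply hg
    rw [pencilObstruction, ← hz, h0, contract_zero, Matrix.adjugate_zero]
    rfl
  obtain ⟨i, hi⟩ := Function.ne_iff.1 hz0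
  have hi' : (contract T y).adjugate i i₁ ≠ 0 := hi
  have hy0 : y ≠ 0 := by
    intro h0
    apply hi'
    rw [h0, contract_zero, Matrix.adjugate_zero]
    rfl
  have hyz : (contract T y).mulVec z = 0 := by
    ext k
    have := congrFun (congrFun (Matrix.mul_adjugate (contract T y)) k) i₁
    rw [hdet, zero_smul] at this
    exact this
  exact ⟨y, z, hyz, Matrix.rank_add_one_of_adjugate_ne_zero hi' hyz hz0,
    Matrix.rank_add_one_of_adjugate_ne_zero hg (by rw [contract_mulVec_comm hT, hyz]) hy0⟩

/-- Let H be the matrix of the pencil direction. Scaling e_{i₀} by det H avoids inverting H: adj(H)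
times the matrix of the pencil point is det(H)(t - N), with N = `pencilMatrix`. -/
theorem det_pencilPoint_eq_zero {T : Fin n → Fin n → Fin n → L} {i₀ i₁ : Fin n}
    (hc : pencilDet T i₀ i₁ ≠ 0) {t : L} (ht : (pencilMatrix T i₀ i₁).charpoly.eval t = 0) :
    (contract T (pencilPoint i₀ i₁ (pencilDet T i₀ i₁) t)).det = 0 := by
  set H := contract T (pencilDirection L i₀ i₁) with hH
  have hc' : H.det ≠ 0 := hc
  have h1 : H.adjugate * contract T (pencilPoint i₀ i₁ (pencilDet T i₀ i₁) t) =
      H.det • (Matrix.scalar (Fin n) t - pencilMatrix T i₀ i₁) := by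
    rw [pencilPoint, contract_add, contract_smul, contract_smul, ← hH, mul_add, Matrix.mul_smul,
      Matrix.mul_smul, Matrix.adjugate_mul, pencilMatrix, sub_neg_eq_add, smul_add, ← hH,
      Matrix.scalar_apply, ← Matrix.smul_one_eq_diagonal, add_comm, smul_comm]
    rfl
  have h2 := congrArg Matrix.det h1
  rw [Matrix.det_mul, Matrix.det_smul, ← Matrix.eval_charpoly, ht, mul_zero] at h2
  refine (mul_eq_zero.1 h2).resolve_left ?_
  rw [Matrix.det_adjugate]
  exact pow_ne_zero _ hc'

theorem exists_corank_one_pair [IsAlgClosed L] {T : Fin n → Fin n → Fin n → L}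
    (hT : ∀ i j k, T i j k = T i k j) {i₀ i₁ : Fin n} (h01 : i₀ ≠ i₁)
    (hc : pencilDet T i₀ i₁ ≠ 0) (hr : obstructionRemainder T i₀ i₁ ≠ 0) :
    ∃ y z : Fin n → L, (contract T y).mulVec z = 0 ∧ (contract T y).rank + 1 = n ∧
      (contract T z).rank + 1 = n := by
  have hmonic := Matrix.charpoly_monic (pencilMatrix T i₀ i₁)
  have hsplit := IsAlgClosed.splits (pencilMatrix T i₀ i₁).charpoly
  obtain ⟨t, ht, hg⟩ : ∃ t, (pencilMatrix T i₀ i₁).charpoly.eval t = 0 ∧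
      (obstructionPoly T i₀ i₁).eval t ≠ 0 := by
    -- If every eigenvalue were a root of the obstruction g, each of the n linear factors of the
    -- characteristic polynomial would divide g, so their product would divide g^n.
    by_contra! hcon
    apply hr
    rw [obstructionRemainder, Polynomial.modByMonic_eq_zero_iff_dvd hmonic]
    have hcard : (pencilMatrix T i₀ i₁).charpoly.roots.card = n := by
      rw [← hsplit.natDegree_eq_card_roots, Matrix.charpoly_natDegree_eq_dim, Fintype.card_fin]
    have hprod := hsplit.eq_prod_roots_of_monic hmonic
    have hpow : obstructionPoly T i₀ i₁ ^ n = ((pencilMatrix T i₀ i₁).charpoly.roots.map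
        fun _ => obstructionPoly T i₀ i₁).prod := by
      rw [Multiset.map_const', Multiset.prod_replicate, hcard]
    rw [hpow]
    conv_lhs => rw [hprod]
    refine Multiset.prod_dvd_prod_of_dvd _ _ fun a ha => ?_
    exact Polynomial.dvd_iff_isRoot.2 (hcon a (Polynomial.isRoot_of_mem_roots ha))
  rw [obstructionPoly_eval] at hg
  exact pencil_corank_one hT h01 (det_pencilPoint_eq_zero hc ht) hg

end CorankOneOfAdjugate

/-! ### The trilinear form of a cubic -/

section ThirdDerivatives

variable {K : Type*} [Field K] {n : ℕ}

/-- The constant terms of the third derivatives. -/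
noncomputable def thirdDeriv (f : MvPolynomial (Fin n) K) (i j k : Fin n) : K :=
  coeff 0 (pderiv i (pderiv j (pderiv k f)))

theorem thirdDeriv_eq_apolarForm (f : MvPolynomial (Fin n) K) (i j k : Fin n) :
    thirdDeriv f i j k = apolarForm f (Ideal.Quotient.mk _ (X k) * Ideal.Quotient.mk _ (X i) *
      Ideal.Quotient.mk _ (X j)) := by
  rw [← map_mul, ← map_mul, apolarForm_mk, thirdDeriv, ← diffOp_X, ← diffOp_X, ← diffOp_X,
    ← diffOp_mul_apply, ← diffOp_mul_apply]
  congr 2; ring_nf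

theorem thirdDeriv_comm (f : MvPolynomial (Fin n) K) (i j k : Fin n) :
    thirdDeriv f i j k = thirdDeriv f i k j := by
  rw [thirdDeriv_eq_apolarForm, thirdDeriv_eq_apolarForm]
  congr 1; ring

theorem thirdDeriv_map {L : Type*} [Field L] (φ : K →+* L) (f : MvPolynomial (Fin n) K)
    (i j k : Fin n) : thirdDeriv (map φ f) i j k = φ (thirdDeriv f i j k) := by
  simp only [thirdDeriv, pderiv_map, coeff_map]

theorem apolarHessian_apolarLinear (f : MvPolynomial (Fin n) K) (v : Fin n → K) :
    apolarHessian f (apolarLinear f v) = contract (thirdDeriv f) v := by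
  ext i j
  simp only [apolarHessian, contract, Matrix.of_apply, apolarLinear,
    Fintype.linearCombination_apply, Finset.sum_mul, map_sum, thirdDeriv_eq_apolarForm,
    smul_mul_assoc, map_smul, smul_eq_mul]

/-- The third derivatives of the generic cubic. -/
noncomputable def genericThirdDeriv (K : Type*) [Field K] (n : ℕ) (i j k : Fin n) :
    MvPolynomial {m : Fin n →₀ ℕ // m.degree = 3} K :=
  genericCoeff K n 3 (0 + Finsupp.single i 1 + Finsupp.single j 1 + Finsupp.single k 1) *
    (((0 + Finsupp.single i 1 + Finsupp.single j 1 : Fin n →₀ ℕ) k : MvPolynomial _ K) + 1) *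
    (((0 + Finsupp.single i 1 : Fin n →₀ ℕ) j : MvPolynomial _ K) + 1) *
    (((0 : Fin n →₀ ℕ) i : MvPolynomial _ K) + 1)

theorem eval_genericThirdDeriv {f : MvPolynomial (Fin n) K} (hf : f.IsHomogeneous 3)
    (i j k : Fin n) :
    eval (fun m => coeff m.1 f) (genericThirdDeriv K n i j k) = thirdDeriv f i j k := by
  rw [genericThirdDeriv, thirdDeriv, coeff_pderiv, coeff_pderiv, coeff_pderiv]
  simp only [map_mul, map_add, map_one, map_natCast, eval_genericCoeff hf]

/-- The existence of a corank one pair over the algebraic closure. -/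
theorem exists_isCorankOnePair {L : Type*} [Field L] [CharZero L] [IsAlgClosed L]
    {f : MvPolynomial (Fin n) L} (hf : f.IsHomogeneous 3) {i₀ i₁ : Fin n} (h01 : i₀ ≠ i₁)
    (hc : pencilDet (thirdDeriv f) i₀ i₁ ≠ 0) (hr : obstructionRemainder (thirdDeriv f) i₀ i₁ ≠ 0) :
    ∃ y z, IsCorankOnePair f y z := by
  obtain ⟨y, z, hyz, hy, hz⟩ := exists_corank_one_pair (thirdDeriv_comm f) h01 hc hr
  rw [← apolarHessian_apolarLinear] at hyz hy hz
  refine ⟨apolarLinear f y, apolarLinear f z, apolarLinear_mem y, apolarLinear_mem z, ?_, hy, hz⟩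
  refine eq_zero_of_apolarForm_mul_X hf
    (mul_mem_apolarGrading (apolarLinear_mem y) (apolarLinear_mem z)) fun i => ?_
  rw [← apolarHessian_mulVec, hyz]
  rfl

end ThirdDerivatives

/-! ### A cubic satisfying the pencil conditions -/

section Witness

variable (K : Type*) [Field K] {n : ℕ}

open scoped Classical in
/-- A cubic whose contractions with the first two coordinate vectors have corank one and are
orthogonal. -/
noncomputable def witnessCubic (i₀ i₁ : Fin n) : MvPolynomial (Fin n) K :=
  X i₀ ^ 3 + X i₁ ^ 3 + C 3 * (X i₀ + X i₁) * ∑ k with k ≠ i₀ ∧ k ≠ i₁, X k ^ 2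

theorem witnessCubic_isHomogeneous (i₀ i₁ : Fin n) : (witnessCubic K i₀ i₁).IsHomogeneous 3 := by
  refine ((isHomogeneous_X_pow _ _).add (isHomogeneous_X_pow _ _)).add ?_
  refine IsHomogeneous.mul (m := 1) (n := 2) ?_ (IsHomogeneous.sum _ _ _ fun k _ => isHomogeneous_X_pow _ _)
  exact ((isHomogeneous_X _ _).add (isHomogeneous_X _ _)).C_mul 3

theorem witnessCubic_comm (i₀ i₁ : Fin n) : witnessCubic K i₀ i₁ = witnessCubic K i₁ i₀ := by
  have h : ∀ k, (k ≠ i₀ ∧ k ≠ i₁) ↔ (k ≠ i₁ ∧ k ≠ i₀) := fun k => and_comm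
  simp only [witnessCubic, h]
  ring

theorem pderiv_witnessCubic {i₀ i₁ : Fin n} (h01 : i₀ ≠ i₁) :
    pderiv i₀ (witnessCubic K i₀ i₁) = ∑ k, (if k = i₁ then 0 else C (3 : K)) * X k ^ 2 := by
  classical
  have h1 : pderiv i₀ (∑ k with k ≠ i₀ ∧ k ≠ i₁, X k ^ 2 : MvPolynomial (Fin n) K) = 0 := by
    rw [map_sum]
    refine Finset.sum_eq_zero fun k hk => ?_
    rw [pderiv_pow, pderiv_X_of_ne (Finset.mem_filter.1 hk).2.1, mul_zero]
  have h2 : ∑ k, (if k = i₁ then 0 else C (3 : K)) * (X k : MvPolynomial (Fin n) K) ^ 2 =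
      C 3 * X i₀ ^ 2 + C 3 * ∑ k with k ≠ i₀ ∧ k ≠ i₁, X k ^ 2 := by
    rw [← Finset.add_sum_erase _ _ (Finset.mem_univ i₀), if_neg h01, Finset.mul_sum]
    congr 1
    have h3 : (Finset.univ.filter fun k => k ≠ i₀ ∧ k ≠ i₁) = (Finset.univ.erase i₀).erase i₁ := by
      ext k; simp [and_comm]
    rw [h3, ← Finset.add_sum_erase _ _ (Finset.mem_erase.2 ⟨h01.symm, Finset.mem_univ i₁⟩),
      if_pos rfl, zero_mul, zero_add]
    exact Finset.sum_congr rfl fun k hk => by rw [if_neg (Finset.ne_of_mem_erase hk)]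
  rw [h2, witnessCubic, map_add, map_add, pderiv_pow, pderiv_pow, pderiv_mul, h1, pderiv_C_mul,
    map_add, pderiv_X_self, pderiv_X_of_ne h01.symm]
  have h3 : (C (3 : K) : MvPolynomial (Fin n) K) = 3 := map_ofNat C 3
  rw [h3]
  push_cast
  ring

/-- The matrix is diagonal with its only zero at i₁. Exchanging i₀ and i₁ gives the mirror
statement, so e_{i₀}, e_{i₁} form a corank-one pair while e_{i₀} + e_{i₁} has invertible matrix. -/
theorem contract_witnessCubic {i₀ i₁ : Fin n} (h01 : i₀ ≠ i₁) :
    contract (thirdDeriv (witnessCubic K i₀ i₁)) (Pi.single i₀ 1) =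
      Matrix.diagonal fun i => if i = i₁ then 0 else 6 := by
  classical
  rw [contract_single]
  ext i j
  rw [Matrix.of_apply, thirdDeriv, pderiv_witnessCubic K h01, map_sum, map_sum, coeff_sum,
    Finset.sum_eq_single j]
  · have h : pderiv j ((if j = i₁ then 0 else C (3 : K)) * X j ^ 2 : MvPolynomial (Fin n) K) =
        C (if j = i₁ then 0 else 6) * X j := by
      split_ifs
      · simp
      · rw [pderiv_C_mul, pderiv_pow, pderiv_X_self, mul_one, pow_one, ← mul_assoc]
        congr 1
        rw [← map_natCast (C : K →+* MvPolynomial (Fin n) K), ← map_mul]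
        norm_num
    rw [h, pderiv_C_mul, coeff_C_mul, pderiv_X, Matrix.diagonal_apply]
    by_cases hij : i = j
    · subst hij; simp
    · rw [if_neg hij, Pi.single_eq_of_ne (Ne.symm hij), coeff_zero, mul_zero]
  · intro k _ hk
    have h : pderiv j ((if k = i₁ then 0 else C (3 : K)) * X k ^ 2 : MvPolynomial (Fin n) K) = 0 := by
      rw [pderiv_mul, pderiv_pow, pderiv_X_of_ne hk]
      split_ifs <;> simp
    rw [h, map_zero, coeff_zero]
  · exact fun h => absurd (Finset.mem_univ _) h

variable [CharZero K]

theorem pencilDet_witnessCubic_ne_zero {i₀ i₁ : Fin n} (h01 : i₀ ≠ i₁) :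
    pencilDet (thirdDeriv (witnessCubic K i₀ i₁)) i₀ i₁ ≠ 0 := by
  have h1 := contract_witnessCubic K h01.symm
  rw [witnessCubic_comm] at h1
  rw [pencilDet, pencilDirection, contract_add, contract_witnessCubic K h01, h1,
    Matrix.diagonal_add, Matrix.det_diagonal, Finset.prod_ne_zero_iff]
  intro i _
  by_cases h : i = i₁
  · subst h; rw [if_pos rfl, if_neg h01.symm]; norm_num
  · rw [if_neg h]
    split_ifs <;> norm_num

theorem obstructionRemainder_witnessCubic_ne_zero {i₀ i₁ : Fin n} (h01 : i₀ ≠ i₁) :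
    obstructionRemainder (thirdDeriv (witnessCubic K i₀ i₁)) i₀ i₁ ≠ 0 := by
  classical
  have h0 := contract_witnessCubic K h01
  have h1 := contract_witnessCubic K h01.symm
  rw [witnessCubic_comm] at h1
  have hc := pencilDet_witnessCubic_ne_zero K h01
  intro hr
  rw [obstructionRemainder,
    Polynomial.modByMonic_eq_zero_iff_dvd (Matrix.charpoly_monic _)] at hr
  -- The witnessing parameter is t = 0, where the pencil point is a multiple of e_{i₀} and the
  -- adjugate column a multiple of e_{i₁}.
  have hchar : (pencilMatrix (thirdDeriv (witnessCubic K i₀ i₁)) i₀ i₁).charpoly.eval 0 = 0 := by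
    rw [Matrix.eval_charpoly, map_zero, zero_sub, pencilMatrix, neg_neg, Matrix.det_mul, h0,
      Matrix.det_diagonal, Finset.prod_eq_zero (Finset.mem_univ i₁) (by rw [if_pos rfl]), mul_zero]
  have hev : ((obstructionPoly (thirdDeriv (witnessCubic K i₀ i₁)) i₀ i₁) ^ n).eval 0 = 0 := by
    obtain ⟨q, hq⟩ := hr
    rw [hq, Polynomial.eval_mul, hchar, zero_mul]
  rw [Polynomial.eval_pow, obstructionPoly_eval] at hev
  refine absurd (eq_zero_of_pow_eq_zero hev) ?_
  set c := pencilDet (thirdDeriv (witnessCubic K i₀ i₁)) i₀ i₁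
  have hcol : adjugateColumn (thirdDeriv (witnessCubic K i₀ i₁)) i₁ (pencilPoint i₀ i₁ c 0) =
      (∏ j ∈ Finset.univ.erase i₁, c * (if j = i₁ then 0 else 6)) • Pi.single i₁ 1 := by
    ext i
    rw [adjugateColumn, pencilPoint, zero_smul, add_zero, contract_smul, h0,
      ← Matrix.diagonal_smul, Matrix.adjugate_diagonal, Matrix.diagonal_apply]
    by_cases hi : i = i₁
    · subst hi; simp
    · rw [if_neg hi, Pi.smul_apply, Pi.single_eq_of_ne hi, smul_zero]
  rw [pencilObstruction, hcol, contract_smul, h1, ← Matrix.diagonal_smul, Matrix.adjugate_diagonal,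
    Matrix.diagonal_apply_eq]
  refine Finset.prod_ne_zero_iff.2 fun j hj => ?_
  refine mul_ne_zero (Finset.prod_ne_zero_iff.2 fun k hk => mul_ne_zero hc ?_) ?_
  · rw [if_neg (Finset.ne_of_mem_erase hk)]; norm_num
  · simp only [if_neg (Finset.ne_of_mem_erase hj)]; norm_num

end Witness

/-! ### Genericity and conclusion -/

section Main

theorem HoldsForGenericForm.and {K : Type*} [Field K] {n d : ℕ}
    {Q Q' : MvPolynomial (Fin n) K → Prop} (h : HoldsForGenericForm K n d Q)
    (h' : HoldsForGenericForm K n d Q') : HoldsForGenericForm K n d fun f => Q f ∧ Q' f := by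
  obtain ⟨P, hP, hQ⟩ := h
  obtain ⟨P', hP', hQ'⟩ := h'
  refine ⟨P * P', mul_ne_zero hP hP', fun f hf hne => ?_⟩
  rw [map_mul] at hne
  exact ⟨hQ f hf (left_ne_zero_of_mul hne), hQ' f hf (right_ne_zero_of_mul hne)⟩

theorem holdsForGenericForm_isSmoothForm (K : Type*) [Field K] [CharZero K] (n : ℕ) :
    HoldsForGenericForm K n 3 IsSmoothForm :=
  ⟨_, genericJacobianMatrix_det_ne_zero, fun f hf hne =>
    isSmoothForm_of_jacobianMatrix_det_ne_zero hf (by rwa [eval_genericJacobianMatrix_det hf] at hne)⟩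

theorem holdsForGenericForm_pencil (K : Type*) [Field K] [CharZero K] {n : ℕ} {i₀ i₁ : Fin n}
    (h01 : i₀ ≠ i₁) : HoldsForGenericForm K n 3 fun f =>
      pencilDet (thirdDeriv f) i₀ i₁ ≠ 0 ∧ obstructionRemainder (thirdDeriv f) i₀ i₁ ≠ 0 := by
  have hw := witnessCubic_isHomogeneous K i₀ i₁
  have hmap : ∀ {f : MvPolynomial (Fin n) K}, f.IsHomogeneous 3 →
      (fun i j k => eval (fun m : {m : Fin n →₀ ℕ // m.degree = 3} => coeff m.1 f)
        (genericThirdDeriv K n i j k)) = thirdDeriv f := fun hf => by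
    ext i j k; exact eval_genericThirdDeriv hf i j k
  -- Fixes one coefficient of the remainder, nonzero at the witness; times the pencil determinant it
  -- gives the polynomial defining the open set.
  obtain ⟨k, hk⟩ : ∃ k, (obstructionRemainder (thirdDeriv (witnessCubic K i₀ i₁)) i₀ i₁).coeff k ≠ 0 := by
    by_contra! h
    exact obstructionRemainder_witnessCubic_ne_zero K h01 (Polynomial.ext h)
  have hev : ∀ {f : MvPolynomial (Fin n) K}, f.IsHomogeneous 3 →
      eval (fun m : {m : Fin n →₀ ℕ // m.degree = 3} => coeff m.1 f)
        (pencilDet (genericThirdDeriv K n) i₀ i₁ *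
          (obstructionRemainder (genericThirdDeriv K n) i₀ i₁).coeff k) =
      pencilDet (thirdDeriv f) i₀ i₁ * (obstructionRemainder (thirdDeriv f) i₀ i₁).coeff k := by
    intro f hf
    rw [map_mul, pencilDet_map, ← Polynomial.coeff_map, obstructionRemainder_map, hmap hf]
  refine ⟨pencilDet (genericThirdDeriv K n) i₀ i₁ *
    (obstructionRemainder (genericThirdDeriv K n) i₀ i₁).coeff k, fun h => ?_, fun f hf hne => ?_⟩
  · have := hev hw
    rw [h, map_zero] at this
    exact mul_ne_zero (pencilDet_witnessCubic_ne_zero K h01) hk this.symm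
  · rw [hev hf] at hne
    refine ⟨left_ne_zero_of_mul hne, fun h => right_ne_zero_of_mul hne ?_⟩
    rw [h, Polynomial.coeff_zero]

/-- The corank-one pair, and with it the filtration, is produced over the algebraic closure; only
the Koszul property is brought back to K. -/
theorem isKoszulAlgebra_of_pencil {K : Type u} [Field K] [CharZero K] {n : ℕ} (hn : 3 ≤ n)
    {f : MvPolynomial (Fin n) K} (hf : f.IsHomogeneous 3) {i₀ i₁ : Fin n} (h01 : i₀ ≠ i₁)
    (hc : pencilDet (thirdDeriv f) i₀ i₁ ≠ 0) (hr : obstructionRemainder (thirdDeriv f) i₀ i₁ ≠ 0) :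
    f ≠ 0 ∧ IsKoszulAlgebra (apolarGrading f) := by
  have : Nonempty (Fin n) := ⟨i₀⟩
  have hf0 : f ≠ 0 := by
    rintro rfl
    apply hc
    have h0 : contract (thirdDeriv (0 : MvPolynomial (Fin n) K)) (pencilDirection K i₀ i₁) = 0 := by
      ext i j
      simp [contract, thirdDeriv]
    rw [pencilDet, h0, Matrix.det_zero]
  refine ⟨hf0, ?_⟩
  let φ := algebraMap K (AlgebraicClosure K)
  have hT : thirdDeriv (map φ f) = fun i j k => φ (thirdDeriv f i j k) := by
    ext i j k; exact thirdDeriv_map φ f i j k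
  have : CharZero (AlgebraicClosure K) := charZero_of_injective_algebraMap φ.injective
  obtain ⟨y, z, hyz⟩ := exists_isCorankOnePair (f := map φ f) (hf.map φ) h01
    (by rw [hT, ← pencilDet_map]; exact (map_ne_zero φ).2 hc)
    (by rw [hT, ← obstructionRemainder_map]; exact (Polynomial.map_ne_zero_iff φ.injective).2 hr)
  exact isKoszulAlgebra_of_isKoszulFiltration_map hf hf0 (hyz.isKoszulFiltration (hf.map φ) hn)

end Main

theorem mainTheorem5 (K : Type*) [Field K] [CharZero K] (n : ℕ) :
    (3 ≤ n → ∀ f : MvPolynomial (Fin n) K, f.IsHomogeneous 3 → f ≠ 0 →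
      (∃ y z : MvPolynomial (Fin n) K, y.IsHomogeneous 1 ∧ z.IsHomogeneous 1 ∧
        diffOp (y * z) f = 0 ∧
        quadricRank (diffOp y f) = n - 1 ∧ quadricRank (diffOp z f) = n - 1) →
      ∃ F : Set (Ideal (ApolarAlgebra f)), IsKoszulFiltration (apolarGrading f) F) ∧
    (∀ f : MvPolynomial (Fin n) K, f.IsHomogeneous 3 → f ≠ 0 → IsSmoothForm f →
      ¬ IsGQuadratic (apolarGrading f)) ∧
    (3 ≤ n → HoldsForGenericForm K n 3 fun f =>
      IsKoszulAlgebra (apolarGrading f) ∧ ¬ IsGQuadratic (apolarGrading f)) := by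
  refine ⟨fun hn f hf _ ⟨y, z, hy, hz, hyz, hyr, hzr⟩ =>
    exists_isKoszulFiltration hf hn hy hz hyz hyr hzr,
    fun f hf hf0 hs => not_isGQuadratic_of_isSmoothForm hf hf0 hs, fun hn => ?_⟩
  have h01 : (⟨0, by omega⟩ : Fin n) ≠ ⟨1, by omega⟩ := by simp
  obtain ⟨P, hP, h⟩ := (holdsForGenericForm_isSmoothForm K n).and (holdsForGenericForm_pencil K h01)
  refine ⟨P, hP, fun f hf hne => ?_⟩
  obtain ⟨hs, hc, hr⟩ := h f hf hne
  obtain ⟨hf0, hk⟩ := isKoszulAlgebra_of_pencil hn hf h01 hc hr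
  exact ⟨hk, not_isGQuadratic_of_isSmoothForm hf hf0 hs⟩
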